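/- A discrete OCF game $\mathcal G=\langle N,W,v\rangle$ consists of agents $N=\{1,\dots,n\}$, weights $W\in\mathbb Z_{\ge 0}^n$ and a function $v:\mathcal W\to\mathbb R_{\ge 0}$ with $v(0)=0$ on the set $\mathcal W=\{c\in\mathbb Z_{\ge 0}^n: c\le W\}$ of coalitions; $\mathrm{supp}(c)=\{i:c^i>0\}$ and $W_M=\max_i W_i$. It is a $2$-OCF game if $v(c)=0$ whenever $|\mathrm{supp}(c)|>2$, and has a tree interaction structure if there is a tree $T$ on $N$ such that $v(c)=0$ whenever $\mathrm{supp}(c)$ does not induce a connected subgraph of $T$. A coalition structure is a finite list $CS=(c_1,\dots,c_m)$ of coalitions with $\sum_j c_j\le W$; $v(CS)=\sum_j v(c_j)$, and $v^*(c)$ is the maximum of $v(CS)$ over all $CS$ with $\sum_j c_j=c$. An outcome is a pair $(CS,x)$ with $x=(x_1,\dots,x_m)$, $x_j\in\mathbb R_{\ge0}^n$, $\sum_i x_j^i=v(c_j)$, $x_j^i=0$ for $i\notin\mathrm{supp}(c_j)$, and $\sum_j x_j^i\ge v^*(W^{\{i\}})$ for every $i$, where $W^{\{i\}}$ has $i$-th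 coordinate $W_i$ and all other coordinates $0$. For $S\subseteq N$ let $\mathrm{Out}_S=\{j:\mathrm{supp}(c_j)\not\subseteq S\}$. A deviation of $S$ is a family $d=(d_j)_{j\in\mathrm{Out}_S}$ of vectors in $\mathbb Z_{\ge 0}^n$ with $d_j\le c_j$ and $d_j^i=0$ for $i\notin S$. An arbitration function $\mathcal A$ assigns to every outcome $(CS,x)$, set $S$ and deviation $d$ real payments $\alpha_j(CS,x,S,d)$, $j\in \mathrm{Out}_S$; it is local if $\alpha_j(CS,x,S,d)$ depends only on $c_j$, $d_j$, $x_j$ and $S$ (and $\mathcal G$). Let $\mathcal A^*(CS,x,S)$ be the supremum of $v(CS'')+\sum_{j\in\mathrm{Out}_S}\alpha_j(CS,x,S,d)$ over all deviations $d$ of $S$ and all coalition structures $CS''$ whose coalitions have support in $S$ and which use at most $W_i-\sum_{j\in\mathrm{Out}_S}(c_j^i-d_j^i)$ of the weight of each $i\in S$. An instance of ArbVal is a tuple $\langle\mathcal G,\mathcal A,S,(CS,x),V\rangle$ with $S\subseteq N$, $(CS,x)$ an outcome and $V\in\mathbb Q$; it is a yes-instance iff $\mathcal A^*(CS,x,S)\ge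 V$. **Theorem.** ArbVal is decidable in time polynomial in $n$ and $W_M$ on all instances in which $\mathcal A$ is local, $\mathcal G$ is a discrete $2$-OCF game with a tree interaction structure, and every coalition of $CS$ has a support of size $1$ or $2$. That is, there are one program and one polynomial $p$ such that on every such instance the program halts with the correct answer after at most $p(n,W_M)$ steps. Here a program has random access to $n$, $W$, $S$, $CS$, $x$, $V$, and oracle access to $v$ and to the payments $\alpha_j(CS,x,S,\cdot)$ at the given outcome and set $S$ (the tree is not given to it); its steps are oracle queries, additions, subtractions and comparisons of natural or real numbers, reading and writing memory cells, and branching, each at unit cost. -/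

import Mathlib

open scoped Classical BigOperators

noncomputable section

namespace OCF

/-! ### Discrete games with overlapping coalitions -/

/-- A coalition: agent `i` contributes an integer amount between `0` and its weight `W i`. -/
abbrev Coalition {n : ℕ} (W : Fin n → ℕ) : Type := {c : Fin n → ℕ // c ≤ W}

/-- The support of a contribution vector. -/
def supp {n : ℕ} (c : Fin n → ℕ) : Finset (Fin n) := Finset.univ.filter (fun i => 0 < c i)

/-- A discrete OCF game with agents `Fin n`, weights `W`, and a nonnegative characteristic function
`v` for which the coalition without any contribution is worth nothing. -/
@[ext] structure Game (n : ℕ) where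
  W : Fin n → ℕ
  v : Coalition W → ℝ
  v_nonneg : ∀ c, 0 ≤ v c
  v_zero : ∀ c : Coalition W, c.1 = 0 → v c = 0

/-- The maximal weight of an agent. -/
def Game.maxWeight {n : ℕ} (G : Game n) : ℕ := Finset.univ.sup G.W

/-- `k`-OCF games: coalitions with more than `k` contributors are worth nothing. -/
def Game.IsKOCF {n : ℕ} (G : Game n) (k : ℕ) : Prop :=
  ∀ c : Coalition G.W, k < (supp c.1).card → G.v c = 0

/-- The game reduced to an interaction graph `Γ`: a coalition keeps its value if its support
induces a connected subgraph of `Γ`, and is worth nothing otherwise. -/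
def Game.reduce {n : ℕ} (G : Game n) (Γ : SimpleGraph (Fin n)) : Game n where
  W := G.W
  v := fun c => if (Γ.induce (↑(supp c.1) : Set (Fin n))).Connected then G.v c else 0
  v_nonneg := fun c => by
    split_ifs
    · exact G.v_nonneg c
    · exact le_rfl
  v_zero := fun c hc => by
    split_ifs
    · exact G.v_zero c hc
    · rfl

/-- The game equals its own reduction to some tree on the set of agents. -/
def Game.HasTreeInteraction {n : ℕ} (G : Game n) : Prop :=
  ∃ T : SimpleGraph (Fin n), T.IsTree ∧ G = G.reduce T

/-- A coalition structure: a finite list of coalitions (repetitions allowed) in which no agent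
contributes more than its weight in total. -/
structure CoalitionStructure {n : ℕ} (G : Game n) where
  size : ℕ
  coal : Fin size → Coalition G.W
  feasible : ∀ i, ∑ j, (coal j).1 i ≤ G.W i

namespace CoalitionStructure

variable {n : ℕ} {G : Game n}

/-- `v(CS)`. -/
def value (CS : CoalitionStructure G) : ℝ := ∑ j, G.v (CS.coal j)

/-- `w(CS)`. -/
def weight (CS : CoalitionStructure G) : Fin n → ℕ := fun i => ∑ j, (CS.coal j).1 i

/-- Every coalition is supported by members of `S` only. -/
def FormedBy (CS : CoalitionStructure G) (S : Finset (Fin n)) : Prop :=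
  ∀ j, supp (CS.coal j).1 ⊆ S

/-- The (positions of) coalitions in `CS ∖ CS|_S`, i.e. those whose support is not
contained in `S`. -/
abbrev Outer (CS : CoalitionStructure G) (S : Finset (Fin n)) : Type :=
  {j : Fin CS.size // ¬ supp (CS.coal j).1 ⊆ S}

end CoalitionStructure

/-- The superadditive cover `v*`; the set below is nonempty and bounded,
see `bddAbove_value`. -/
def Game.cover {n : ℕ} (G : Game n) (c : Coalition G.W) : ℝ :=
  sSup {r | ∃ CS : CoalitionStructure G, CS.weight = c.1 ∧ r = CS.value}

/-- The coalition to which agent `i` contributes its whole weight and nobody else contributes. -/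
def Game.alone {n : ℕ} (G : Game n) (i : Fin n) : Coalition G.W :=
  ⟨fun k => if k = i then G.W k else 0, fun k => by dsimp only; split_ifs <;> simp⟩

/-- An outcome: a coalition structure with an imputation. -/
structure Outcome {n : ℕ} (G : Game n) where
  CS : CoalitionStructure G
  x : Fin CS.size → Fin n → ℝ
  x_nonneg : ∀ j i, 0 ≤ x j i
  efficient : ∀ j, ∑ i, x j i = G.v (CS.coal j)
  no_side_payments : ∀ j i, i ∉ supp (CS.coal j).1 → x j i = 0
  individually_rational : ∀ i, G.cover (G.alone i) ≤ ∑ j, x j i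

/-- A deviation of `S`: from each coalition of `CS ∖ CS|_S`, members of `S`
withdraw at most what they have contributed, and other agents withdraw nothing. -/
structure Deviation {n : ℕ} {G : Game n} (CS : CoalitionStructure G) (S : Finset (Fin n)) where
  d : CS.Outer S → Fin n → ℕ
  d_le : ∀ j, d j ≤ (CS.coal j.1).1
  d_out : ∀ j, ∀ i ∉ S, d j i = 0

/-- An arbitration function: given an outcome, a deviating set and a deviation, it says how much
(possibly a negative amount) each coalition of `CS ∖ CS|_S` pays to the deviating set. -/
def ArbitrationFunction {n : ℕ} (G : Game n) : Type :=
  ∀ (o : Outcome G) (S : Finset (Fin n)), Deviation o.CS S → o.CS.Outer S → ℝ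

/-- Locality (for the game `G`): the payment of a coalition `c` depends only on `c`, on what is
withdrawn from `c`, on how the profit of `c` is divided, and on the deviating set. -/
def ArbitrationFunction.IsLocal {n : ℕ} {G : Game n} (A : ArbitrationFunction G) : Prop :=
  ∃ f : Coalition G.W → (Fin n → ℕ) → (Fin n → ℝ) → Finset (Fin n) → ℝ,
    ∀ (o : Outcome G) (S : Finset (Fin n)) (D : Deviation o.CS S) (j : o.CS.Outer S),
      A o S D j = f (o.CS.coal j.1) (D.d j) (o.x j.1) S

/-- `CS''` is formed by `S` from the resources that `S` does not leave in coalitions of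
`CS ∖ CS|_S` after the deviation `D`. -/
def Deviation.Allows {n : ℕ} {G : Game n} {CS : CoalitionStructure G} {S : Finset (Fin n)}
    (D : Deviation CS S) (CS'' : CoalitionStructure G) : Prop :=
  CS''.FormedBy S ∧
    ∀ i ∈ S, CS''.weight i + ∑ j : CS.Outer S, ((CS.coal j.1).1 i - D.d j i) ≤ G.W i

/-- All total payoffs that `S` can receive by deviating from `o` under `A`. -/
def deviationPayoffs {n : ℕ} {G : Game n} (A : ArbitrationFunction G) (o : Outcome G)
    (S : Finset (Fin n)) : Set ℝ :=
  {r | ∃ (D : Deviation o.CS S) (CS'' : CoalitionStructure G), D.Allows CS'' ∧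
    r = CS''.value + ∑ j : o.CS.Outer S, A o S D j}

/-- `A*(CS, x, S)`, the most that `S` can get by deviating; the supremum is over a nonempty bounded
set, see `deviationPayoffs_nonempty` and `bddAbove_deviationPayoffs`. -/
def ArbitrationFunction.best {n : ℕ} {G : Game n} (A : ArbitrationFunction G) (o : Outcome G)
    (S : Finset (Fin n)) : ℝ :=
  sSup (deviationPayoffs A o S)

theorem bddAbove_value {n : ℕ} (G : Game n) :
    ∃ B : ℝ, ∀ CS : CoalitionStructure G, CS.value ≤ B := by
  have : Finite (Coalition G.W) := (Set.finite_Iic G.W).to_subtype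
  obtain ⟨M, hM⟩ := (Set.finite_range G.v).bddAbove
  have hM' : ∀ c, G.v c ≤ M := fun c => hM ⟨c, rfl⟩
  have hM0 : 0 ≤ M := (G.v_nonneg ⟨0, fun _ => Nat.zero_le _⟩).trans (hM' _)
  have key : ∀ c : Coalition G.W, G.v c ≤ M * ((∑ i, c.1 i : ℕ) : ℝ) := by
    intro c
    by_cases h : (∑ i, c.1 i) = 0
    · have hc : c.1 = 0 := by
        funext i
        exact (Finset.sum_eq_zero_iff.1 h) i (Finset.mem_univ i)
      rw [G.v_zero c hc, h]; simp
    · have h1 : (1 : ℝ) ≤ ((∑ i, c.1 i : ℕ) : ℝ) := by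
        exact_mod_cast Nat.one_le_iff_ne_zero.2 h
      nlinarith [hM' c]
  refine ⟨M * ((∑ i, G.W i : ℕ) : ℝ), fun CS => ?_⟩
  calc CS.value ≤ ∑ j, M * ((∑ i, (CS.coal j).1 i : ℕ) : ℝ) :=
        Finset.sum_le_sum fun j _ => key _
    _ = M * ((∑ i, ∑ j, (CS.coal j).1 i : ℕ) : ℝ) := by
        rw [← Finset.mul_sum, Finset.sum_comm]; push_cast; rfl
    _ ≤ _ := by
        apply mul_le_mul_of_nonneg_left _ hM0
        exact_mod_cast Finset.sum_le_sum fun i _ => CS.feasible i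

theorem deviationPayoffs_nonempty {n : ℕ} {G : Game n} (A : ArbitrationFunction G)
    (o : Outcome G) (S : Finset (Fin n)) : (deviationPayoffs A o S).Nonempty := by
  refine ⟨_, ⟨fun _ _ => 0, fun _ _ => Nat.zero_le _, fun _ _ _ => rfl⟩,
    ⟨0, Fin.elim0, fun i => by simp⟩, ⟨fun j => j.elim0, fun i _ => ?_⟩, rfl⟩
  have h := o.CS.feasible i
  have h2 : ∑ j : o.CS.Outer S, (o.CS.coal j.1).1 i ≤ ∑ j, (o.CS.coal j).1 i := by
    rw [← Finset.sum_subtype (Finset.univ.filter fun j => ¬ supp (o.CS.coal j).1 ⊆ S)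
      (by simp) (fun j => (o.CS.coal j).1 i)]
    exact Finset.sum_le_sum_of_subset (Finset.filter_subset _ _)
  simpa [CoalitionStructure.weight] using h2.trans h

theorem bddAbove_deviationPayoffs {n : ℕ} {G : Game n} (A : ArbitrationFunction G)
    (o : Outcome G) (S : Finset (Fin n)) : BddAbove (deviationPayoffs A o S) := by
  have : Finite (Deviation o.CS S) := by
    have : Finite (Set.Iic fun j : o.CS.Outer S => (o.CS.coal j.1).1) :=
      (Set.finite_Iic _).to_subtype
    refine Finite.of_injective
      (fun D : Deviation o.CS S =>
        (⟨D.d, D.d_le⟩ : Set.Iic fun j : o.CS.Outer S => (o.CS.coal j.1).1)) ?_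
    rintro ⟨d, _, _⟩ ⟨d', _, _⟩ h
    obtain rfl : d = d' := congrArg Subtype.val h
    rfl
  obtain ⟨B, hB⟩ := bddAbove_value G
  obtain ⟨M, hM⟩ := (Set.finite_range
    fun D : Deviation o.CS S => ∑ j : o.CS.Outer S, A o S D j).bddAbove
  refine ⟨B + M, ?_⟩
  rintro r ⟨D, CS'', _, rfl⟩
  exact add_le_add (hB _) (hM ⟨D, rfl⟩)

/-! ### Oracle programs and their running time

Programs work on two kinds of two-dimensional arrays with named (numbered) arrays: index arrays
hold natural numbers, value arrays hold real numbers.  Numbers can only be added,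
subtracted (truncated subtraction in the case of natural numbers), compared and copied. -/

/-- The memory of a program: cell `(i, j)` of array `a` is `idx a i j`, respectively `val a i j`. -/
structure Memory where
  idx : ℕ → ℕ → ℕ → ℕ
  val : ℕ → ℕ → ℕ → ℝ

/-- Overwrite one cell. -/
def write {α : Type} (f : ℕ → ℕ → ℕ → α) (a i j : ℕ) (y : α) : ℕ → ℕ → ℕ → α :=
  fun a' i' j' => if a' = a ∧ i' = i ∧ j' = j then y else f a' i' j'

/-- Expressions for natural numbers. -/
inductive IdxExpr where
  | const (k : ℕ)
  | read (a : ℕ) (i j : IdxExpr)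
  | add (e₁ e₂ : IdxExpr)
  | sub (e₁ e₂ : IdxExpr)

def IdxExpr.eval (s : Memory) : IdxExpr → ℕ
  | const k => k
  | read a i j => s.idx a (i.eval s) (j.eval s)
  | add e₁ e₂ => e₁.eval s + e₂.eval s
  | sub e₁ e₂ => e₁.eval s - e₂.eval s

/-- The number of operations needed to evaluate an expression. -/
def IdxExpr.cost : IdxExpr → ℕ
  | const _ => 1
  | read _ i j => i.cost + j.cost + 1
  | add e₁ e₂ => e₁.cost + e₂.cost + 1
  | sub e₁ e₂ => e₁.cost + e₂.cost + 1

/-- Expressions for real numbers. -/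
inductive ValExpr where
  | zero
  | read (a : ℕ) (i j : IdxExpr)
  | add (e₁ e₂ : ValExpr)
  | sub (e₁ e₂ : ValExpr)

def ValExpr.eval (s : Memory) : ValExpr → ℝ
  | zero => 0
  | read a i j => s.val a (i.eval s) (j.eval s)
  | add e₁ e₂ => e₁.eval s + e₂.eval s
  | sub e₁ e₂ => e₁.eval s - e₂.eval s

def ValExpr.cost : ValExpr → ℕ
  | zero => 1
  | read _ i j => i.cost + j.cost + 1
  | add e₁ e₂ => e₁.cost + e₂.cost + 1
  | sub e₁ e₂ => e₁.cost + e₂.cost + 1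

/-- Tests. -/
inductive Test where
  | idxLe (e₁ e₂ : IdxExpr)
  | valLe (e₁ e₂ : ValExpr)
  | not (b : Test)
  | and (b₁ b₂ : Test)

def Test.holds (s : Memory) : Test → Prop
  | idxLe e₁ e₂ => e₁.eval s ≤ e₂.eval s
  | valLe e₁ e₂ => e₁.eval s ≤ e₂.eval s
  | not b => ¬ b.holds s
  | and b₁ b₂ => b₁.holds s ∧ b₂.holds s

def Test.cost : Test → ℕ
  | idxLe e₁ e₂ => e₁.cost + e₂.cost + 1
  | valLe e₁ e₂ => e₁.cost + e₂.cost + 1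
  | not b => b.cost + 1
  | and b₁ b₂ => b₁.cost + b₂.cost + 1

/-- Programs. -/
inductive Program where
  | skip
  /-- Write the number `e` into cell `(i, j)` of the index array `a`. -/
  | setIdx (a : ℕ) (i j : IdxExpr) (e : IdxExpr)
  /-- Write the number `e` into cell `(i, j)` of the value array `a`. -/
  | setVal (a : ℕ) (i j : IdxExpr) (e : ValExpr)
  /-- Query the value of the coalition in row `r` of the index array `q`, and write the answer into
  cell `(i, j)` of the value array `a`. -/
  | queryValue (a : ℕ) (i j : IdxExpr) (q : ℕ) (r : IdxExpr)
  /-- Query the payment of coalition number `k` under the deviation whose withdrawal from coalition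
  number `l` is row `l` of the index array `q`, and write the answer into cell `(i, j)` of the
  value array `a`. -/
  | queryPayment (a : ℕ) (i j : IdxExpr) (q : ℕ) (k : IdxExpr)
  | seq (P Q : Program)
  | cond (b : Test) (P Q : Program)
  | loop (b : Test) (P : Program)

/-- What a program can query: the first component receives a row of an index array, the second
one a whole index array and the number of a coalition. -/
structure Oracles where
  value : (ℕ → ℕ) → ℝ
  payment : (ℕ → ℕ → ℕ) → ℕ → ℝ

/-- `Run O P s s' t`: started in memory `s` with the oracles `O`, the program `P` halts in memory
`s'` after `t` steps.  Each assignment, query and test costs one step, plus one for each node of the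
expressions that are evaluated. -/
inductive Run (O : Oracles) : Program → Memory → Memory → ℕ → Prop where
  | skip (s : Memory) : Run O .skip s s 1
  | setIdx (s : Memory) (a : ℕ) (i j e : IdxExpr) :
      Run O (.setIdx a i j e) s
        { s with idx := write s.idx a (i.eval s) (j.eval s) (e.eval s) }
        (i.cost + j.cost + e.cost + 1)
  | setVal (s : Memory) (a : ℕ) (i j : IdxExpr) (e : ValExpr) :
      Run O (.setVal a i j e) s
        { s with val := write s.val a (i.eval s) (j.eval s) (e.eval s) }
        (i.cost + j.cost + e.cost + 1)
  | queryValue (s : Memory) (a : ℕ) (i j : IdxExpr) (q : ℕ) (r : IdxExpr) :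
      Run O (.queryValue a i j q r) s
        { s with val := write s.val a (i.eval s) (j.eval s) (O.value (s.idx q (r.eval s))) }
        (i.cost + j.cost + r.cost + 1)
  | queryPayment (s : Memory) (a : ℕ) (i j : IdxExpr) (q : ℕ) (k : IdxExpr) :
      Run O (.queryPayment a i j q k) s
        { s with val := write s.val a (i.eval s) (j.eval s) (O.payment (s.idx q) (k.eval s)) }
        (i.cost + j.cost + k.cost + 1)
  | seq {P Q : Program} {s s' s'' : Memory} {t t' : ℕ} :
      Run O P s s' t → Run O Q s' s'' t' → Run O (.seq P Q) s s'' (t + t' + 1)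
  | condTrue {b : Test} {P Q : Program} {s s' : Memory} {t : ℕ} :
      b.holds s → Run O P s s' t → Run O (.cond b P Q) s s' (b.cost + t + 1)
  | condFalse {b : Test} {P Q : Program} {s s' : Memory} {t : ℕ} :
      ¬ b.holds s → Run O Q s s' t → Run O (.cond b P Q) s s' (b.cost + t + 1)
  | loopDone {b : Test} {P : Program} {s : Memory} :
      ¬ b.holds s → Run O (.loop b P) s s (b.cost + 1)
  | loopStep {b : Test} {P : Program} {s s' s'' : Memory} {t t' : ℕ} :
      b.holds s → Run O P s s' t → Run O (.loop b P) s' s'' t' →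
        Run O (.loop b P) s s'' (b.cost + t + t' + 1)

/-- Programs are deterministic. -/
theorem Run.unique {O : Oracles} {P : Program} {s s₁ s₂ : Memory} {t₁ t₂ : ℕ}
    (h₁ : Run O P s s₁ t₁) (h₂ : Run O P s s₂ t₂) : s₁ = s₂ ∧ t₁ = t₂ := by
  induction h₁ generalizing s₂ t₂ with
  | skip | setIdx | setVal | queryValue | queryPayment => cases h₂; exact ⟨rfl, rfl⟩
  | seq _ _ ih ih' =>
    cases h₂ with
    | seq h h' =>
      obtain ⟨rfl, rfl⟩ := ih h
      obtain ⟨rfl, rfl⟩ := ih' h'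
      exact ⟨rfl, rfl⟩
  | condTrue hb _ ih =>
    cases h₂ with
    | condTrue _ h => obtain ⟨rfl, rfl⟩ := ih h; exact ⟨rfl, rfl⟩
    | condFalse hb' _ => exact absurd hb hb'
  | condFalse hb _ ih =>
    cases h₂ with
    | condTrue hb' _ => exact absurd hb' hb
    | condFalse _ h => obtain ⟨rfl, rfl⟩ := ih h; exact ⟨rfl, rfl⟩
  | loopDone hb =>
    cases h₂ with
    | loopDone _ => exact ⟨rfl, rfl⟩
    | loopStep hb' _ _ => exact absurd hb' hb
  | loopStep hb _ _ ih ih' =>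
    cases h₂ with
    | loopDone hb' => exact absurd hb hb'
    | loopStep _ h h' =>
      obtain ⟨rfl, rfl⟩ := ih h
      obtain ⟨rfl, rfl⟩ := ih' h'
      exact ⟨rfl, rfl⟩

/-! ### The decision problem -/

/-- An instance of ArbVal: a game, an arbitration function, an outcome, a deviating set and
a threshold. -/
structure ArbInstance (n : ℕ) where
  G : Game n
  A : ArbitrationFunction G
  o : Outcome G
  S : Finset (Fin n)
  V : ℚ

namespace ArbInstance

variable {n : ℕ}

/-- Yes-instances. -/
def IsYes (I : ArbInstance n) : Prop := (I.V : ℝ) ≤ I.A.best I.o I.S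

/-- A finite vector as a sequence, padded by zeros. -/
def pad {α : Type} [Zero α] {m : ℕ} (f : Fin m → α) : ℕ → α :=
  fun i => if h : i < m then f ⟨i, h⟩ else 0

/-- The explicitly given part of the instance: the number of agents and the number of coalitions
(index array `0`), the weights (index array `1`), the deviating set (index array `2`), the
coalitions (index array `3`), the threshold (value array `0`) and the imputation (value array `1`).
All other cells are zero. -/
def input (I : ArbInstance n) : Memory where
  idx
    | 0, 0, 0 => n
    | 0, 0, 1 => I.o.CS.size
    | 1, 0, i => pad I.G.W i
    | 2, 0, i => pad (fun i : Fin n => if i ∈ I.S then 1 else 0) i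
    | 3, j, i => pad (fun j : Fin I.o.CS.size => pad (I.o.CS.coal j).1) j i
    | _, _, _ => 0
  val
    | 0, 0, 0 => (I.V : ℝ)
    | 1, j, i => pad (fun j : Fin I.o.CS.size => pad (I.o.x j)) j i
    | _, _, _ => 0

/-- Oracle access to the characteristic function and to the arbitration function, the latter only
at the given outcome and deviating set.  Queries which do not describe a coalition, or a deviation
and a coalition of `CS ∖ CS|_S`, are answered by `0`. -/
def oracles (I : ArbInstance n) : Oracles where
  value := fun row =>
    if h : (fun i : Fin n => row i) ≤ I.G.W then I.G.v ⟨fun i : Fin n => row i, h⟩ else 0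
  payment := fun q k =>
    if h : (∃ hk : k < I.o.CS.size, ¬ supp (I.o.CS.coal ⟨k, hk⟩).1 ⊆ I.S) ∧
        (∀ l : I.o.CS.Outer I.S, (fun i : Fin n => q l.1 i) ≤ (I.o.CS.coal l.1).1) ∧
        (∀ l : I.o.CS.Outer I.S, ∀ i ∉ I.S, q l.1 i = 0) then
      I.A I.o I.S ⟨fun l i => q l.1 i, h.2.1, h.2.2⟩ ⟨⟨k, h.1.1⟩, h.1.2⟩
    else 0

/-- The program `P` correctly answers the instance `I` in at most `t` steps: the answer (`1` for yes,
`0` for no) is left in cell `(0, 0)` of index array `0`. -/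
def DecidedWithin (I : ArbInstance n) (P : Program) (t : ℕ) : Prop :=
  ∃ (s : Memory) (t' : ℕ), Run I.oracles P I.input s t' ∧ t' ≤ t ∧
    s.idx 0 0 0 = if I.IsYes then 1 else 0

end ArbInstance

end OCF

end

noncomputable section

namespace OCF

/-! ### A program logic -/

namespace Program

/-! The best payoff of `S` is found by dynamic programming, eliminating agents as leaves of the
tree. A coalition of $CS$ with a contributor outside `S` has at most one contributor inside, and by
locality its payment depends only on that agent's withdrawal. So the outer coalitions decouple: for
every agent `i`, the best sum `f i w` of payments when `i` leaves at most `w` units in its outer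
coalitions is a knapsack problem (`isGreatest_payments_insert`). It remains to maximise the value of
the coalitions formed inside `S` plus `∑ f i (w i)`, where `w i` is what `i` does not put into them;
these totals form the set `feasible`.

Coalitions of value zero can be dropped, and the others live on single agents or on edges of the
tree. The tree is unknown to the program, but the pairs that have a joint coalition of positive
value form a subgraph of it. Hence every nonempty set of agents has a member `k` with at most one
partner `p` in the set (`exists_leaf`). Such a `k` is removed by replacing `f p a` with the best
joint payoff of `p` and `k` from resources `a` and `U k` (`exists_le_of_feasible`,
`feasible_of_feasible`). The joint payoffs form a table indexed by two amounts, filled by splitting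
off one coalition at a time (`isBestPair_of_isGreatest`).

A dummy agent `n` without resources has two roles: it owns the outer coalitions that have no
contributor in `S`, whose payments still count, and it is the partner of agents without neighbour.
After `n` eliminations the optimum is `f n 0`. Optimality is sandwiched: the upper bound is tracked
for structures of profitable coalitions, where the tree restricts supports, and attainability for
arbitrary structures.

For the running time, `WP` combines partial correctness with a bound that is polynomial in the
number of loop iterations (`exists_bound_le`), and every loop runs at most `(n + 1) * (W_M + 1)`
times. -/

/-- A bound for the running time of a program none of whose loops is iterated more than `B`
times. -/
def bound (B : ℕ) : Program → ℕ
  | skip => 1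
  | setIdx _ i j e => i.cost + j.cost + e.cost + 1
  | setVal _ i j e => i.cost + j.cost + e.cost + 1
  | queryValue _ i j _ r => i.cost + j.cost + r.cost + 1
  | queryPayment _ i j _ k => i.cost + j.cost + k.cost + 1
  | seq P Q => P.bound B + Q.bound B + 1
  | cond b P Q => b.cost + (P.bound B + Q.bound B) + 1
  | loop b P => B * (b.cost + P.bound B + 1) + (b.cost + 1)

/-- Structural induction: sums add the degrees, and a loop raises the degree by one. The constants
depend on the program only, which makes the final polynomial uniform in the instance. -/
theorem exists_bound_le (P : Program) : ∃ C d : ℕ, ∀ B, P.bound B ≤ C * (B + 1) ^ d := by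
  have base : ∀ c : ℕ, ∃ C d : ℕ, ∀ B : ℕ, c ≤ C * (B + 1) ^ d := fun c => ⟨c, 0, by simp⟩
  have add : ∀ f g : ℕ → ℕ, (∃ C d : ℕ, ∀ B, f B ≤ C * (B + 1) ^ d) →
      (∃ C d : ℕ, ∀ B, g B ≤ C * (B + 1) ^ d) →
      ∃ C d : ℕ, ∀ B, f B + g B ≤ C * (B + 1) ^ d := by
    rintro f g ⟨C, d, h⟩ ⟨C', d', h'⟩
    refine ⟨C + C', d + d', fun B => ?_⟩
    rw [add_mul]
    refine add_le_add ((h B).trans ?_) ((h' B).trans ?_) <;>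
      exact Nat.mul_le_mul_left _ (Nat.pow_le_pow_right B.succ_pos (by omega))
  induction P with
  | skip | setIdx | setVal | queryValue | queryPayment => exact base _
  | seq P Q ihP ihQ => exact add _ _ (add _ _ ihP ihQ) (base 1)
  | cond b P Q ihP ihQ => exact add _ _ (add _ _ (base b.cost) (add _ _ ihP ihQ)) (base 1)
  | loop b P ih =>
    obtain ⟨C, d, h⟩ := add _ _ (add _ _ (base b.cost) ih) (base 1)
    refine add _ _ ⟨C, d + 1, fun B => ?_⟩ (base (b.cost + 1))
    calc B * (b.cost + P.bound B + 1) ≤ (B + 1) * (C * (B + 1) ^ d) :=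
          Nat.mul_le_mul (Nat.le_succ B) (h B)
      _ = C * (B + 1) ^ (d + 1) := by ring

/-- The index arrays to which a program writes. -/
def idxWrites : Program → List ℕ
  | setIdx a _ _ _ => [a]
  | seq P Q => P.idxWrites ++ Q.idxWrites
  | cond _ P Q => P.idxWrites ++ Q.idxWrites
  | loop _ P => P.idxWrites
  | _ => []

/-- The value arrays to which a program writes. -/
def valWrites : Program → List ℕ
  | setVal a _ _ _ => [a]
  | queryValue a _ _ _ _ => [a]
  | queryPayment a _ _ _ _ => [a]
  | seq P Q => P.valWrites ++ Q.valWrites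
  | cond _ P Q => P.valWrites ++ Q.valWrites
  | loop _ P => P.valWrites
  | _ => []

end Program

theorem write_of_ne {α : Type} {f : ℕ → ℕ → ℕ → α} {a a' : ℕ} (h : a' ≠ a) (i j : ℕ) (y : α) :
    write f a i j y a' = f a' := by
  funext i' j'
  simp [write, h]

/-- The memories `s` and `s'` differ at most in the index arrays `X` and the value arrays `Y`. -/
def Frame (X Y : List ℕ) (s s' : Memory) : Prop :=
  (∀ a, a ∉ X → s'.idx a = s.idx a) ∧ ∀ a, a ∉ Y → s'.val a = s.val a

theorem Frame.refl (X Y : List ℕ) (s : Memory) : Frame X Y s s :=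
  ⟨fun _ _ => rfl, fun _ _ => rfl⟩

theorem Frame.trans {X Y : List ℕ} {s s' s'' : Memory} (h : Frame X Y s s')
    (h' : Frame X Y s' s'') : Frame X Y s s'' :=
  ⟨fun a ha => (h'.1 a ha).trans (h.1 a ha), fun a ha => (h'.2 a ha).trans (h.2 a ha)⟩

theorem Frame.mono {X Y X' Y' : List ℕ} {s s' : Memory} (h : Frame X Y s s')
    (hX : X ⊆ X') (hY : Y ⊆ Y') : Frame X' Y' s s' :=
  ⟨fun a ha => h.1 a fun h' => ha (hX h'), fun a ha => h.2 a fun h' => ha (hY h')⟩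

/-- Arrays that do not occur as targets in the program text are untouched. This spares all later
invariants from mentioning them. -/
theorem Run.frame {O : Oracles} {P : Program} {s s' : Memory} {t : ℕ} (h : Run O P s s' t) :
    Frame P.idxWrites P.valWrites s s' := by
  induction h with
  | skip => exact Frame.refl _ _ _
  | setIdx | setVal | queryValue | queryPayment =>
    constructor <;> intro a ha
    all_goals first
      | rfl
      | exact write_of_ne (by simpa [Program.idxWrites, Program.valWrites] using ha) _ _ _
  | seq _ _ ih ih' =>
    exact (ih.mono (List.subset_append_left _ _) (List.subset_append_left _ _)).trans
      (ih'.mono (List.subset_append_right _ _) (List.subset_append_right _ _))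
  | condTrue _ _ ih =>
    exact ih.mono (List.subset_append_left _ _) (List.subset_append_left _ _)
  | condFalse _ _ ih =>
    exact ih.mono (List.subset_append_right _ _) (List.subset_append_right _ _)
  | loopDone => exact Frame.refl _ _ _
  | loopStep _ _ _ ih ih' => exact ih.trans ih'

/-- Started in `s`, the program `P` halts within `P.bound B` steps in a memory satisfying `R`. -/
def WP (O : Oracles) (B : ℕ) (P : Program) (R : Memory → Prop) (s : Memory) : Prop :=
  ∃ (s' : Memory) (t : ℕ), Run O P s s' t ∧ t ≤ P.bound B ∧ R s'

namespace WP

variable {O : Oracles} {B : ℕ} {P Q : Program} {R R' : Memory → Prop} {s : Memory}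

theorem mono (h : WP O B P R s) (hR : ∀ s', R s' → R' s') : WP O B P R' s := by
  obtain ⟨s', t, hr, ht, h⟩ := h
  exact ⟨s', t, hr, ht, hR _ h⟩

theorem frame (h : WP O B P R s) :
    WP O B P (fun s' => R s' ∧ Frame P.idxWrites P.valWrites s s') s := by
  obtain ⟨s', t, hr, ht, h⟩ := h
  exact ⟨s', t, hr, ht, h, hr.frame⟩

theorem skip (h : R s) : WP O B .skip R s := ⟨s, 1, .skip s, le_rfl, h⟩

theorem setIdx {a : ℕ} {i j e : IdxExpr}
    (h : R { s with idx := write s.idx a (i.eval s) (j.eval s) (e.eval s) }) :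
    WP O B (.setIdx a i j e) R s := ⟨_, _, .setIdx .., le_rfl, h⟩

theorem setVal {a : ℕ} {i j : IdxExpr} {e : ValExpr}
    (h : R { s with val := write s.val a (i.eval s) (j.eval s) (e.eval s) }) :
    WP O B (.setVal a i j e) R s := ⟨_, _, .setVal .., le_rfl, h⟩

theorem queryValue {a q : ℕ} {i j r : IdxExpr}
    (h : R { s with val := write s.val a (i.eval s) (j.eval s) (O.value (s.idx q (r.eval s))) }) :
    WP O B (.queryValue a i j q r) R s := ⟨_, _, .queryValue .., le_rfl, h⟩

theorem queryPayment {a q : ℕ} {i j k : IdxExpr}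
    (h : R { s with
      val := write s.val a (i.eval s) (j.eval s) (O.payment (s.idx q) (k.eval s)) }) :
    WP O B (.queryPayment a i j q k) R s := ⟨_, _, .queryPayment .., le_rfl, h⟩

theorem seq (h : WP O B P (WP O B Q R) s) : WP O B (.seq P Q) R s := by
  obtain ⟨s', t, hr, ht, s'', t', hr', ht', h⟩ := h
  exact ⟨s'', _, .seq hr hr', by simp only [Program.bound]; omega, h⟩

theorem cond {b : Test} (hP : b.holds s → WP O B P R s) (hQ : ¬ b.holds s → WP O B Q R s) :
    WP O B (.cond b P Q) R s := by
  by_cases hb : b.holds s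
  · obtain ⟨s', t, hr, ht, h⟩ := hP hb
    exact ⟨s', _, .condTrue hb hr, by simp only [Program.bound]; omega, h⟩
  · obtain ⟨s', t, hr, ht, h⟩ := hQ hb
    exact ⟨s', _, .condFalse hb hr, by simp only [Program.bound]; omega, h⟩

/-- Total correctness with an exact iteration count: the invariant is indexed by the number of
completed rounds, and the test must fail precisely at `N`. -/
theorem loop {b : Test} (N : ℕ) (hN : N ≤ B) (Inv : ℕ → Memory → Prop) (h0 : Inv 0 s)
    (hstep : ∀ m < N, ∀ s', Inv m s' → b.holds s' ∧ WP O B P (Inv (m + 1)) s')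
    (hend : ∀ s', Inv N s' → ¬ b.holds s' ∧ R s') : WP O B (.loop b P) R s := by
  have aux : ∀ (k m : ℕ) (s : Memory), m + k = N → Inv m s → ∃ s' t, Run O (.loop b P) s s' t ∧
      t ≤ k * (b.cost + P.bound B + 1) + (b.cost + 1) ∧ R s' := by
    intro k
    induction k with
    | zero =>
      intro m s hm hs
      obtain rfl : m = N := hm
      exact ⟨s, _, .loopDone (hend s hs).1, by omega, (hend s hs).2⟩
    | succ k ih =>
      intro m s hm hs
      obtain ⟨hb, s', t, hr, ht, hs'⟩ := hstep m (by omega) s hs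
      obtain ⟨s'', t', hr', ht', h⟩ := ih (m + 1) s' (by omega) hs'
      refine ⟨s'', _, .loopStep hb hr hr', ?_, h⟩
      rw [add_mul]
      omega
  obtain ⟨s', t, hr, ht, h⟩ := aux N 0 s (by omega) h0
  refine ⟨s', t, hr, ht.trans ?_, h⟩
  simp only [Program.bound]
  gcongr

end WP

/-! ### Registers and counting loops -/

/-- The expression for the number stored in cell `(0, 0)` of the index array `a`. -/
def iv (a : ℕ) : IdxExpr := .read a (.const 0) (.const 0)

/-- The expression for the number stored in cell `(0, 0)` of the value array `a`. -/
def vv (a : ℕ) : ValExpr := .read a (.const 0) (.const 0)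

/-- `for v < e do P`, with the counter in cell `(0, 0)` of the index array `v`. -/
def forLt (v : ℕ) (e : IdxExpr) (P : Program) : Program :=
  .seq (.setIdx v (.const 0) (.const 0) (.const 0))
    (.loop (.not (.idxLe e (iv v)))
      (.seq P (.setIdx v (.const 0) (.const 0) (.add (iv v) (.const 1)))))

/-- The bound `e` is evaluated anew in every round, so `he` demands its value in all memories
reachable under the frame; `hInv` makes the invariant blind to the counter. -/
theorem WP.forLt {O : Oracles} {B v : ℕ} {e : IdxExpr} {P : Program} {R : Memory → Prop}
    {s : Memory} (N : ℕ) (hN : N ≤ B) (Inv : ℕ → Memory → Prop) (hv : v ∉ P.idxWrites)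
    (he : ∀ s', Frame (v :: P.idxWrites) P.valWrites s s' → e.eval s' = N)
    (hInv : ∀ m s' x, Inv m s' → Inv m { s' with idx := write s'.idx v 0 0 x })
    (h0 : Inv 0 s)
    (hstep : ∀ m < N, ∀ s', Frame (v :: P.idxWrites) P.valWrites s s' → s'.idx v 0 0 = m →
      Inv m s' → WP O B P (Inv (m + 1)) s')
    (hR : ∀ s', Frame (v :: P.idxWrites) P.valWrites s s' → Inv N s' → R s') :
    WP O B (OCF.forLt v e P) R s := by
  have fr : ∀ (s' : Memory) (x : ℕ),
      Frame (v :: P.idxWrites) P.valWrites s' { s' with idx := write s'.idx v 0 0 x } :=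
    fun s' x => ⟨fun a ha => write_of_ne (fun h => ha (by simp [h])) _ _ _, fun _ _ => rfl⟩
  refine .seq (.setIdx (.loop N hN (fun m s' => Frame (v :: P.idxWrites) P.valWrites s s' ∧
    s'.idx v 0 0 = m ∧ Inv m s') ?_ ?_ ?_))
  · exact ⟨fr s 0, by simp [write, IdxExpr.eval], hInv _ _ _ h0⟩
  · rintro m hm s' ⟨hf, hm', hi⟩
    refine ⟨by simp [Test.holds, iv, IdxExpr.eval, he s' hf, hm', hm], .seq ?_⟩
    refine (hstep m hm s' hf hm' hi).frame.mono fun s'' h => .setIdx ?_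
    have hv' : s''.idx v 0 0 = m := by rw [h.2.1 v hv, hm']
    have hf' := hf.trans (h.2.mono (List.subset_cons_self _ _) (List.Subset.refl _))
    refine ⟨hf'.trans (fr s'' _), by simp [write, IdxExpr.eval, iv, hv'], hInv _ _ _ h.1⟩
  · rintro s' ⟨hf, hm', hi⟩
    exact ⟨by simp [Test.holds, iv, IdxExpr.eval, he s' hf, hm'], hR s' hf hi⟩

/-! ### The recursions behind the algorithm -/

/-- The contribution vector with `k`-th coordinate `w`, `p`-th coordinate `u`, and no others. -/
def pairRow (p k u w : ℕ) : ℕ → ℕ := fun i => if i = k then w else if i = p then u else 0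

/-- The withdrawal of `t` units by agent `g` from coalition number `j`. -/
def single (j g t : ℕ) : ℕ → ℕ → ℕ := fun j' g' => if j' = j ∧ g' = g then t else 0

/-! ### Payments to one agent as a knapsack problem -/

/-- What an agent can obtain from the coalitions in `J`, to which it has contributed `c`, if it
leaves at most `w` units in them, and coalition `j` pays `α j d` for a withdrawal of `d` units. -/
def payments (α : ℕ → ℕ → ℝ) (c : ℕ → ℕ) (J : Finset ℕ) (w : ℕ) : Set ℝ :=
  {r | ∃ u : ℕ → ℕ, (∀ j ∈ J, u j ≤ c j) ∧ ∑ j ∈ J, u j ≤ w ∧ r = ∑ j ∈ J, α j (c j - u j)}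

theorem isGreatest_payments_empty (α : ℕ → ℕ → ℝ) (c : ℕ → ℕ) (w : ℕ) :
    IsGreatest (payments α c ∅ w) 0 := by
  refine ⟨⟨0, by simp⟩, ?_⟩
  rintro r ⟨u, -, -, rfl⟩
  simp

/-- The knapsack step: fix the amount `u` left in the new coalition `j`, at most `c j` and at most
`w`, and use the optimum for `w - u` on the old coalitions. The running maximum `partialSups` is the
form in which a program computes this. -/
theorem isGreatest_payments_insert {α : ℕ → ℕ → ℝ} {c : ℕ → ℕ} {J : Finset ℕ} {j w : ℕ}
    {F : ℕ → ℝ} (hj : j ∉ J) (hF : ∀ w' ≤ w, IsGreatest (payments α c J w') (F w')) :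
    IsGreatest (payments α c (insert j J) w)
      (partialSups (fun u => F (w - u) + α j (c j - u)) (min (c j) w)) := by
  constructor
  · obtain ⟨m, hm, h⟩ := exists_partialSups_eq (fun u => F (w - u) + α j (c j - u)) (min (c j) w)
    rw [h]
    obtain ⟨u, hu, hs, hr⟩ := (hF (w - m) (Nat.sub_le _ _)).1
    have hne : ∀ x ∈ J, x ≠ j := fun x hx h => hj (h ▸ hx)
    refine ⟨Function.update u j m, ?_, ?_, ?_⟩
    · intro x hx
      rcases Finset.mem_insert.1 hx with rfl | hx
      · simp; omega
      · simpa [Function.update_of_ne (hne x hx)] using hu x hx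
    · rw [Finset.sum_insert hj, Finset.sum_congr rfl
        fun x hx => Function.update_of_ne (hne x hx) m u, Function.update_self]
      change m + ∑ x ∈ J, u x ≤ w
      omega
    · rw [Finset.sum_insert hj, Finset.sum_congr rfl
        fun x hx => by rw [Function.update_of_ne (hne x hx) m u], ← hr]
      simp [add_comm]
  · rintro r ⟨u, hu, hs, rfl⟩
    rw [Finset.sum_insert hj] at hs ⊢
    have h1 := hu j (Finset.mem_insert_self _ _)
    have h2 : ∑ x ∈ J, α x (c x - u x) ≤ F (w - u j) :=
      (hF _ (Nat.sub_le _ _)).2 ⟨u, fun x hx => hu x (Finset.mem_insert_of_mem hx), by omega, rfl⟩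
    have h3 := le_partialSups_of_le (fun u => F (w - u) + α j (c j - u))
      (show u j ≤ min (c j) w by omega)
    linarith

/-! ### Coalitions of two agents -/

/-- The total payoffs when the agents in `A` form coalitions with property `Q`, and agent `i ∈ A`
obtains `f i w` with the part `w` of its resources `U i` that it does not contribute to them. -/
def feasible (val : (ℕ → ℕ) → ℝ) (U : ℕ → ℕ) (Q : (ℕ → ℕ) → Prop) (A : Finset ℕ)
    (f : ℕ → ℕ → ℝ) : Set ℝ :=
  {r | ∃ (L : Multiset (ℕ → ℕ)) (w : ℕ → ℕ), (∀ c ∈ L, Q c ∧ ∀ i ∉ A, c i = 0) ∧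
    (∀ i ∈ A, (L.map fun c => c i).sum + w i = U i) ∧
    r = (L.map val).sum + ∑ i ∈ A, f i (w i)}

/-- The best total payoffs of two agents `p` and `k` with resources `a` and `b`. -/
def IsBestPair (val : (ℕ → ℕ) → ℝ) (p k : ℕ) (f : ℕ → ℕ → ℝ) (a b : ℕ) (r : ℝ) : Prop :=
  IsGreatest (feasible val (pairRow p k a b) (fun _ => True) {p, k} f) r

/-- The payoffs of two agents if they form no coalition, or one of the coalitions satisfying `X`
followed by what `H` says. -/
def pairCandidates (val : (ℕ → ℕ) → ℝ) (p k : ℕ) (f H : ℕ → ℕ → ℝ) (a b : ℕ)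
    (X : ℕ → ℕ → Prop) : Set ℝ :=
  {r | r = f p a + f k b ∨ ∃ u w, X u w ∧ u ≤ a ∧ w ≤ b ∧ 0 < u + w ∧
    r = H (a - u) (b - w) + val (pairRow p k u w)}

/-- Either the two agents form no coalition, or a nonzero one can be split off, which leaves the
same problem for strictly smaller total resources. -/
theorem isBestPair_of_isGreatest {val : (ℕ → ℕ) → ℝ} {p k : ℕ} {f H : ℕ → ℕ → ℝ} {a b : ℕ}
    {r : ℝ} (hv : val 0 = 0) (hpk : p ≠ k)
    (hH : ∀ a' ≤ a, ∀ b' ≤ b, a' + b' < a + b → IsBestPair val p k f a' b' (H a' b'))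
    (hr : IsGreatest (pairCandidates val p k f H a b fun _ _ => True) r) :
    IsBestPair val p k f a b r := by
  have hrow : ∀ u w, pairRow p k u w p = u := fun u w => by simp [pairRow, hpk]
  have hrow' : ∀ u w, pairRow p k u w k = w := fun u w => by simp [pairRow]
  constructor
  · rcases hr.1 with h | ⟨u, w, -, hu, hw, h0, h⟩
    · exact ⟨0, pairRow p k a b, by simp, by simp, by simp [h, Finset.sum_pair hpk, hrow, hrow']⟩
    · obtain ⟨L, x, hL, hx, hr'⟩ := (hH (a - u) (Nat.sub_le _ _) (b - w) (Nat.sub_le _ _)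
        (by omega)).1
      refine ⟨pairRow p k u w ::ₘ L, x, ?_, ?_, ?_⟩
      · intro c hc
        rcases Multiset.mem_cons.1 hc with rfl | hc
        · refine ⟨trivial, fun i hi => ?_⟩
          simp only [Finset.mem_insert, Finset.mem_singleton, not_or] at hi
          simp [pairRow, hi.1, hi.2]
        · exact hL c hc
      · intro i hi
        have := hx i hi
        rw [Multiset.map_cons, Multiset.sum_cons]
        rcases Finset.mem_insert.1 hi with rfl | hi
        · rw [hrow] at this ⊢; rw [hrow]; omega
        · rw [Finset.mem_singleton.1 hi] at this ⊢
          rw [hrow'] at this ⊢; rw [hrow']; omega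
      · rw [h, hr', Multiset.map_cons, Multiset.sum_cons]; ring
  · rintro y ⟨L, x, hL, hx, rfl⟩
    induction L using Multiset.induction with
    | empty =>
      refine hr.2 (Or.inl ?_)
      have h1 := hx p (by simp)
      have h2 := hx k (by simp)
      simp only [hrow, hrow', Multiset.map_zero, Multiset.sum_zero, zero_add] at h1 h2
      simp [Finset.sum_pair hpk, h1, h2]
    | cons c L ih =>
      have hc : c = pairRow p k (c p) (c k) := by
        funext i
        by_cases h1 : i = k
        · simp [h1, hrow']
        by_cases h2 : i = p
        · simp [h2, hrow]
        simpa [pairRow, h1, h2] using (hL c (by simp)).2 i (by simp [h1, h2])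
      have hL' : ∀ c' ∈ L, True ∧ ∀ i ∉ ({p, k} : Finset ℕ), c' i = 0 :=
        fun c' hc' => hL c' (Multiset.mem_cons_of_mem hc')
      simp only [Multiset.map_cons, Multiset.sum_cons] at hx ⊢
      have h1 := hx p (by simp)
      have h2 := hx k (by simp)
      rw [hrow] at h1
      rw [hrow'] at h2
      -- A zero coalition leaves the resources unchanged, so the smaller table entries do not apply.
      -- It is worth nothing and is discarded by the induction on `L`.
      by_cases h0 : c p + c k = 0
      · have hc0 : c = 0 := by
          rw [hc]
          funext i
          simp only [pairRow, Pi.zero_apply]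
          split_ifs <;> omega
        subst hc0
        simpa [hv] using ih hL' (by simpa using hx)
      · have h3 := (hH (a - c p) (Nat.sub_le _ _) (b - c k) (Nat.sub_le _ _) (by omega)).2
          ⟨L, x, hL', ?_, rfl⟩
        · have h4 := hr.2 (Or.inr ⟨c p, c k, trivial, by omega, by omega, by omega, rfl⟩)
          rw [← hc] at h4
          linarith
        · intro i hi
          rcases Finset.mem_insert.1 hi with rfl | hi
          · rw [hrow]; omega
          · rw [Finset.mem_singleton.1 hi, hrow']; omega

/-! ### Elimination of an agent with a single partner -/

section Absorb

variable {val : (ℕ → ℕ) → ℝ} {U : ℕ → ℕ} {A : Finset ℕ} {p k : ℕ} {f f' : ℕ → ℕ → ℝ} {r : ℝ}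

theorem sum_coordinate_eq_zero {L : Multiset (ℕ → ℕ)} {i : ℕ} (h : ∀ c ∈ L, c i = 0) :
    (L.map fun c => c i).sum = 0 := by
  rw [Multiset.map_congr rfl h]
  simp

/-- If agent `k` only forms coalitions with agent `p`, it may leave the deal to `p`. -/
theorem exists_le_of_feasible {Q : (ℕ → ℕ) → Prop} (hk : k ∈ A) (hp : p ∈ A) (hpk : p ≠ k)
    (hQ : ∀ c, Q c → (∀ i ∉ A, c i = 0) → 0 < c k → ∀ i, i ≠ p → i ≠ k → c i = 0)
    (hf : ∀ i, i ≠ p → f' i = f i)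
    (hf' : ∀ a ≤ U p, IsBestPair val p k f a (U k) (f' p a)) (hr : r ∈ feasible val U Q A f) :
    ∃ r' ∈ feasible val U Q (A.erase k) f', r ≤ r' := by
  obtain ⟨L, w, hL, hw, rfl⟩ := hr
  have hp' : p ∈ A.erase k := Finset.mem_erase.2 ⟨hpk, hp⟩
  set L₁ := L.filter fun c => 0 < c k
  set L₂ := L.filter fun c => ¬ 0 < c k
  have hsum : ∀ {M : Type} [AddCommMonoid M] (g : (ℕ → ℕ) → M),
      (L.map g).sum = (L₁.map g).sum + (L₂.map g).sum := by
    intro M _ g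
    rw [← Multiset.sum_add, ← Multiset.map_add, Multiset.filter_add_not]
  have hL₁ : ∀ c ∈ L₁, ∀ i, i ≠ p → i ≠ k → c i = 0 := fun c hc =>
    hQ c (hL c (Multiset.mem_filter.1 hc).1).1 (hL c (Multiset.mem_filter.1 hc).1).2
      (Multiset.mem_filter.1 hc).2
  have hL₂ : ∀ c ∈ L₂, c k = 0 := fun c hc => by have := (Multiset.mem_filter.1 hc).2; omega
  -- The share of `p` in the deal with `k`: what it puts into coalitions with `k`, plus what it put
  -- into none. This becomes the new leftover of `p`.
  set a := (L₁.map fun c => c p).sum + w p with ha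
  have hwp := hw p hp
  have hwk := hw k hk
  rw [hsum] at hwp hwk
  rw [sum_coordinate_eq_zero hL₂] at hwk
  have haU : a ≤ U p := by omega
  have key : (L₁.map val).sum + (f p (w p) + f k (w k)) ≤ f' p a := by
    rw [← Finset.sum_pair (f := fun i => f i (w i)) hpk]
    refine (hf' a haU).2 ⟨L₁, w, fun c hc => ⟨trivial, fun i hi => ?_⟩, fun i hi => ?_, rfl⟩
    · simp only [Finset.mem_insert, Finset.mem_singleton, not_or] at hi
      exact hL₁ c hc i hi.1 hi.2
    · rcases Finset.mem_insert.1 hi with rfl | hi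
      · simp [pairRow, hpk, ha]
      · rw [Finset.mem_singleton.1 hi]
        simp only [pairRow, if_true]
        omega
  refine ⟨_, ⟨L₂, Function.update w p a, fun c hc => ?_, fun i hi => ?_, rfl⟩, ?_⟩
  · have hc' := (Multiset.mem_filter.1 hc).1
    refine ⟨(hL c hc').1, fun i hi => ?_⟩
    by_cases hik : i = k
    · exact hik ▸ hL₂ c hc
    · exact (hL c hc').2 i fun h => hi (Finset.mem_erase.2 ⟨hik, h⟩)
  · obtain ⟨hik, hiA⟩ := Finset.mem_erase.1 hi
    by_cases hip : i = p
    · rw [hip, Function.update_self]; omega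
    · have := hw i hiA
      rw [hsum, sum_coordinate_eq_zero fun c hc => hL₁ c hc i hip hik] at this
      rw [Function.update_of_ne hip]; omega
  · rw [hsum, ← Finset.add_sum_erase A _ hk, ← Finset.add_sum_erase _ _ hp',
      ← Finset.add_sum_erase (A.erase k) (fun i => f' i _) hp', Function.update_self,
      Finset.sum_congr rfl fun i hi => show f' i (Function.update w p a i) = f i (w i) by
        rw [Function.update_of_ne (Finset.ne_of_mem_erase hi), hf i (Finset.ne_of_mem_erase hi)]]
    linarith

/-- The total payoffs after agent `k` left the deal to `p` are feasible before. -/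
theorem feasible_of_feasible (hk : k ∈ A) (hp : p ∈ A) (hpk : p ≠ k)
    (hf : ∀ i, i ≠ p → f' i = f i)
    (hf' : ∀ a ≤ U p, IsBestPair val p k f a (U k) (f' p a))
    (hr : r ∈ feasible val U (fun _ => True) (A.erase k) f') :
    r ∈ feasible val U (fun _ => True) A f := by
  obtain ⟨L, w, hL, hw, rfl⟩ := hr
  have hp' : p ∈ A.erase k := Finset.mem_erase.2 ⟨hpk, hp⟩
  have hwp := hw p hp'
  -- Undo the deal: an optimal structure for the pair supplies the missing coalitions and the true
  -- leftovers `x` of `p` and `k`.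
  obtain ⟨L₁, x, hL₁, hx, hr⟩ := (hf' (w p) (by omega)).1
  have hxp := hx p (by simp)
  have hxk := hx k (by simp)
  simp only [pairRow, hpk, if_true, if_false] at hxp hxk
  have hne : ∀ i, i ≠ p → i ≠ k → Function.update (Function.update w p (x p)) k (x k) i = w i :=
    fun i h1 h2 => by rw [Function.update_of_ne h2, Function.update_of_ne h1]
  refine ⟨L₁ + L, Function.update (Function.update w p (x p)) k (x k), fun c hc => ?_,
    fun i hi => ?_, ?_⟩
  · rcases Multiset.mem_add.1 hc with hc | hc
    · refine ⟨trivial, fun i hi => (hL₁ c hc).2 i ?_⟩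
      simp only [Finset.mem_insert, Finset.mem_singleton, not_or]
      exact ⟨fun h => hi (h ▸ hp), fun h => hi (h ▸ hk)⟩
    · exact ⟨trivial, fun i hi => (hL c hc).2 i fun h => hi (Finset.mem_of_mem_erase h)⟩
  · rw [Multiset.map_add, Multiset.sum_add]
    by_cases hik : i = k
    · subst hik
      rw [Function.update_self, sum_coordinate_eq_zero fun c hc => (hL c hc).2 i (by simp)]
      omega
    by_cases hip : i = p
    · subst hip
      rw [Function.update_of_ne hpk, Function.update_self]
      omega
    · rw [hne i hip hik, ← hw i (Finset.mem_erase.2 ⟨hik, hi⟩),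
        sum_coordinate_eq_zero fun c hc => (hL₁ c hc).2 i (by simp [hip, hik])]
      omega
  · rw [Multiset.map_add, Multiset.sum_add, ← Finset.add_sum_erase A _ hk,
      ← Finset.add_sum_erase _ _ hp', ← Finset.add_sum_erase (A.erase k) (fun i => f i _) hp',
      Function.update_self, Function.update_of_ne hpk, Function.update_self, hr,
      Finset.sum_pair hpk, Finset.sum_congr rfl fun i hi => by
        obtain ⟨h1, h2⟩ := Finset.mem_erase.1 hi
        rw [hf i h1, ← hne i h1 (Finset.ne_of_mem_erase h2)]]
    ring

end Absorb

/-! ### Leaves of vertex sets in a tree -/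

/-- In a tree, a finite nonempty set of vertices has a member with at most one neighbour
in the set. -/
theorem exists_leaf {V : Type} {T : SimpleGraph V} (hT : T.IsTree) {A : Finset V}
    (hA : A.Nonempty) :
    ∃ k ∈ A, ∀ i ∈ A, ∀ i' ∈ A, T.Adj k i → T.Adj k i' → i = i' := by
  -- A member `k` farthest from an arbitrary root `r` works: any neighbour of `k` in the set is the
  -- last vertex before `k` on the unique path from `r`.
  obtain ⟨r⟩ := hT.connected.nonempty
  obtain ⟨k, hk, hmax⟩ := A.exists_max_image (T.dist r) hA
  refine ⟨k, hk, fun i hi i' hi' h h' => ?_⟩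
  obtain ⟨q, hq, huniq⟩ := hT.existsUnique_path r k
  have key : ∀ i ∈ A, T.Adj k i → q.penultimate = i := by
    intro i hi h
    obtain ⟨p, hp, hlen⟩ := hT.connected.exists_path_of_dist r i
    -- A shortest path to `i` through `k` would make `k` strictly closer to the root than `i`.
    have hks : k ∉ p.support := by
      intro hks
      have h1 := T.dist_le (p.takeUntil k hks)
      have h2 := p.length_takeUntil_lt_length hks h.ne
      have h3 := hmax i hi
      omega
    have h4 : (p.concat h.symm).IsPath := hp.concat hks h.symm
    rw [← huniq _ h4]
    simp
  rw [← key i hi h, key i' hi' h']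

/-! ### The program

Index arrays: `0` sizes, `1` weights, `2` deviating set, `3` coalitions, `4` queried coalition,
`5` queried deviation, `6` interacting pairs, `7` eliminated agents, `8`-`15` and `20` counters,
`16`-`19` the selected pair of agents.
Value arrays: `0` threshold, `2` payoffs of the agents depending on their resources, `3` payoffs of
the selected pair, `4` answers, `5` accumulator. -/

/-- Query the value of `pairRow p k u w`. -/
def askValue (p k u w : IdxExpr) : Program :=
  .seq (.setIdx 4 (.const 0) p u) <| .seq (.setIdx 4 (.const 0) k w) <|
  .seq (.queryValue 4 (.const 0) (.const 0) 4 (.const 0)) <|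
  .seq (.setIdx 4 (.const 0) p (.const 0)) (.setIdx 4 (.const 0) k (.const 0))

/-- The two cells used for the query are cleared afterwards, so array `4` is zero again and no index
array changes on balance. The arguments are evaluated between the writes, hence the hypotheses over
all framed memories. -/
theorem WP.askValue {O : Oracles} {B : ℕ} {R : Memory → Prop} {s : Memory}
    {p k u w : IdxExpr} (p₀ k₀ u₀ w₀ : ℕ)
    (hp : ∀ s', Frame [4] [4] s s' → p.eval s' = p₀)
    (hk : ∀ s', Frame [4] [4] s s' → k.eval s' = k₀)
    (hu : ∀ s', Frame [4] [4] s s' → u.eval s' = u₀)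
    (hw : ∀ s', Frame [4] [4] s s' → w.eval s' = w₀)
    (h4 : s.idx 4 = fun _ _ => 0)
    (h : ∀ s', Frame [] [4] s s' → s'.val 4 0 0 = O.value (pairRow p₀ k₀ u₀ w₀) → R s') :
    WP O B (askValue p k u w) R s := by
  have fi : ∀ (s' : Memory) (i j y : ℕ), Frame [4] [4] s s' →
      Frame [4] [4] s { s' with idx := write s'.idx 4 i j y } := fun s' i j y hs =>
    hs.trans ⟨fun a ha => write_of_ne (by simpa using ha) _ _ _, fun _ _ => rfl⟩
  have fv : ∀ (s' : Memory) (i j : ℕ) (y : ℝ), Frame [4] [4] s s' →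
      Frame [4] [4] s { s' with val := write s'.val 4 i j y } := fun s' i j y hs =>
    hs.trans ⟨fun _ _ => rfl, fun a ha => write_of_ne (by simpa using ha) _ _ _⟩
  have f0 : Frame [4] [4] s s := Frame.refl _ _ _
  refine .seq (.setIdx (.seq (.setIdx (.seq (.queryValue (.seq (.setIdx (.setIdx (h _ ?_ ?_)))))))))
  all_goals
    have f1 := fi _ 0 p₀ u₀ f0
    have f2 := fi _ 0 k₀ w₀ f1
    have f3 := fun x => fv _ 0 0 x f2
    have f4 := fun x => fi _ 0 p₀ 0 (f3 x)
    simp only [IdxExpr.eval, hp _ f0, hu _ f0, hk _ f1, hw _ f1, hp _ (f3 _), hk _ (f4 _)]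
  · refine ⟨fun a _ => ?_, fun a ha => write_of_ne (by simpa using ha) _ _ _⟩
    by_cases ha : a = 4
    · subst ha
      funext i j
      simp only [write, h4]
      grind
    · simp [write_of_ne ha]
  · simp only [write, and_self, if_true]
    congr 1
    funext i
    simp [write, h4, pairRow]

/-- Query the payment for the withdrawal of `e` by the agent in register `10` from the coalition in
register `9`. -/
def askPayment (e : IdxExpr) : Program :=
  .seq (.setIdx 5 (iv 9) (iv 10) e) <|
  .seq (.queryPayment 4 (.const 0) (.const 0) 5 (iv 9)) (.setIdx 5 (iv 9) (iv 10) (.const 0))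

/-- The queried deviation withdraws from coalition `j` only; locality later makes its payment the
right one for every deviation that agrees with it on `j`. -/
theorem WP.askPayment {O : Oracles} {B : ℕ} {R : Memory → Prop} {s : Memory} {e : IdxExpr}
    (j g : ℕ) (hj : s.idx 9 0 0 = j) (hg : s.idx 10 0 0 = g) (h5 : s.idx 5 = fun _ _ => 0)
    (h : ∀ s', Frame [] [4] s s' → s'.val 4 0 0 = O.payment (single j g (e.eval s)) j → R s') :
    WP O B (askPayment e) R s := by
  refine .seq (.setIdx (.seq (.queryPayment (.setIdx (h _ ?_ ?_)))))
  · refine ⟨fun a _ => ?_, fun a ha => write_of_ne (by simpa using ha) _ _ _⟩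
    by_cases ha : a = 5
    · subst ha
      funext i j
      simp [write, h5, IdxExpr.eval, iv]
      grind
    · simp [write_of_ne ha]
  · simp only [write, IdxExpr.eval, iv, hj, hg, and_self, if_true]
    congr 1
    funext j' g'
    simp [write, h5, single]

/-! ### Resources and payments from outer coalitions -/

/-- Set the weights of the agents outside the deviating set to zero. -/
def maskWeights : Program :=
  forLt 8 (iv 0) <| .cond (.idxLe (.read 2 (.const 0) (iv 8)) (.const 0))
    (.setIdx 1 (.const 0) (iv 8) (.const 0)) .skip

theorem WP.maskWeights {O : Oracles} {B : ℕ} {R : Memory → Prop} {s : Memory} (n : ℕ)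
    (hn : s.idx 0 0 0 = n) (hB : n ≤ B)
    (h : ∀ s', Frame [8, 1] [] s s' →
      (∀ i, s'.idx 1 0 i = if i < n ∧ s.idx 2 0 i = 0 then 0 else s.idx 1 0 i) → R s') :
    WP O B maskWeights R s := by
  refine .forLt n hB (fun m s' =>
    ∀ i, s'.idx 1 0 i = if i < m ∧ s.idx 2 0 i = 0 then 0 else s.idx 1 0 i)
    (by decide) ?_ ?_ (by simp) ?_ ?_
  · intro s' hF
    simp [IdxExpr.eval, iv, hF.1 0 (by decide), hn]
  · intro m s' x hi
    simpa [write_of_ne] using hi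
  · intro m hm s' hF hv hi
    have h2 : s'.idx 2 = s.idx 2 := hF.1 2 (by decide)
    refine .cond (fun hb => .setIdx fun i => ?_) (fun hb => .skip fun i => ?_)
    all_goals
      simp only [Test.holds, IdxExpr.eval, iv, hv, h2] at hb
      simp only [write, IdxExpr.eval, iv, hv, hi]
      grind
  · intro s' hF hi
    exact h s' (hF.mono (by decide) (by decide)) hi

/-- Find the member of the deviating set in the coalition in register `9`, or take the dummy agent
`n` if there is none, and find out whether the coalition has other members. -/
def findAgent : Program :=
  .seq (.setIdx 10 (.const 0) (.const 0) (iv 0)) <| .seq (.setIdx 11 (.const 0) (.const 0) (.const 0)) <|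
  forLt 8 (iv 0) <| .cond (.idxLe (.const 1) (.read 3 (iv 9) (iv 8)))
    (.cond (.idxLe (.const 1) (.read 2 (.const 0) (iv 8)))
      (.setIdx 10 (.const 0) (.const 0) (iv 8)) (.setIdx 11 (.const 0) (.const 0) (.const 1)))
    .skip

/-- `g` is a member of `M` in the coalition `c`, or `n` if there is none. -/
def IsAgentOf (n : ℕ) (M c : ℕ → ℕ) (g : ℕ) : Prop :=
  (g = n ∧ ∀ i < n, 0 < c i → M i = 0) ∨ (g < n ∧ 0 < c g ∧ 0 < M g)

/-- If the coalition has several members in the deviating set, the last one is kept; for outer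
coalitions there is no choice, by `eq_agent`. -/
theorem WP.findAgent {O : Oracles} {B : ℕ} {R : Memory → Prop} {s : Memory} (n j : ℕ)
    (hn : s.idx 0 0 0 = n) (hj : s.idx 9 0 0 = j) (hB : n ≤ B)
    (h : ∀ s', Frame [8, 10, 11] [] s s' →
      IsAgentOf n (s.idx 2 0) (s.idx 3 j) (s'.idx 10 0 0) →
      (1 ≤ s'.idx 11 0 0 ↔ ∃ i < n, 0 < s.idx 3 j i ∧ s.idx 2 0 i = 0) → R s') :
    WP O B findAgent R s := by
  refine .seq (.setIdx (.seq (.setIdx ?_)))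
  generalize hs₀ : Memory.mk _ _ = s₀
  have hF₀ : Frame [10, 11] [] s s₀ := by
    subst hs₀
    constructor
    · intro a ha
      simp only [List.mem_cons, List.not_mem_nil, or_false, not_or] at ha
      simp [write_of_ne, ha]
    · simp
  have h10 : s₀.idx 10 0 0 = n := by subst hs₀; simp [write, IdxExpr.eval, iv, hn]
  have h11 : s₀.idx 11 0 0 = 0 := by subst hs₀; simp [write, IdxExpr.eval]
  clear hs₀
  have e0 := hF₀.1 0 (by decide)
  have e2 := hF₀.1 2 (by decide)
  have e3 := hF₀.1 3 (by decide)
  have e9 := hF₀.1 9 (by decide)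
  refine .forLt n hB (fun m s' =>
    ((s'.idx 10 0 0 = n ∧ ∀ i < m, 0 < s.idx 3 j i → s.idx 2 0 i = 0) ∨
      (s'.idx 10 0 0 < n ∧ 0 < s.idx 3 j (s'.idx 10 0 0) ∧ 0 < s.idx 2 0 (s'.idx 10 0 0))) ∧
    (1 ≤ s'.idx 11 0 0 ↔ ∃ i < m, 0 < s.idx 3 j i ∧ s.idx 2 0 i = 0))
    (by decide) ?_ ?_ (by simp [h10, h11]) ?_ ?_
  · intro s' hF
    simp [IdxExpr.eval, iv, hF.1 0 (by decide), e0, hn]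
  · intro m s' x hi
    simpa [write_of_ne] using hi
  · intro m hm s' hF hv hi
    have h2 : s'.idx 2 = s.idx 2 := (hF.1 2 (by decide)).trans e2
    have h3 : s'.idx 3 = s.idx 3 := (hF.1 3 (by decide)).trans e3
    have h9 : s'.idx 9 = s.idx 9 := (hF.1 9 (by decide)).trans e9
    refine .cond (fun hb => .cond (fun hb' => .setIdx ?_) (fun hb' => .setIdx ?_))
      (fun hb => .skip ?_)
    all_goals
      simp only [Test.holds, IdxExpr.eval, iv, hv, h2, h3, h9, hj] at *
      simp [write]
      grind
  · intro s' hF hi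
    exact h s' ((hF₀.mono (by decide) (by decide)).trans (hF.mono (by decide) (by decide))) hi.1 hi.2

/-- For `m = 0` the candidate `g 0` is merely compared with itself. This permits starting the
accumulator at a genuine candidate, as payments may be negative. -/
theorem max_partialSups_pred (g : ℕ → ℝ) (m : ℕ) :
    max (partialSups g (m - 1)) (g m) = partialSups g m := by
  cases m with
  | zero => simp
  | succ m => simp [partialSups_add_one]

/-- `x := max x e` for the accumulator `x`. -/
def accumulate (e : ValExpr) : Program :=
  .cond (.valLe (vv 5) e) (.setVal 5 (.const 0) (.const 0) e) .skip

theorem WP.accumulate {O : Oracles} {B : ℕ} {R : Memory → Prop} {s : Memory} {e : ValExpr}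
    (h : ∀ s', Frame [] [5] s s' → s'.val 5 0 0 = max (s.val 5 0 0) (e.eval s) → R s') :
    WP O B (accumulate e) R s := by
  refine .cond (fun hb => .setVal (h _ ?_ ?_)) (fun hb => .skip (h _ (Frame.refl _ _ _) ?_))
  · exact ⟨fun _ _ => rfl, fun a ha => write_of_ne (by simpa using ha) _ _ _⟩
  · simp only [Test.holds, vv, ValExpr.eval, IdxExpr.eval] at hb
    simp [write, IdxExpr.eval, hb]
  · simp only [Test.holds, vv, ValExpr.eval, IdxExpr.eval] at hb
    exact (max_eq_left (not_le.1 hb).le).symm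

/-- Update the payoffs of the agent in register `10` by the payments of the coalition in
register `9`. -/
def addPayments : Program :=
  forLt 12 (.add (.read 1 (.const 0) (iv 10)) (.const 1)) <|
  .seq (.setIdx 13 (.const 0) (.const 0) (.sub (.read 1 (.const 0) (iv 10)) (iv 12))) <|
  .seq (askPayment (.read 3 (iv 9) (iv 10))) <|
  .seq (.setVal 5 (.const 0) (.const 0) (.add (.read 2 (iv 10) (iv 13)) (vv 4))) <|
  .seq (forLt 14 (.add (.sub (.read 3 (iv 9) (iv 10)) (.sub (.read 3 (iv 9) (iv 10)) (iv 13)))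
      (.const 1)) <|
    .seq (askPayment (.sub (.read 3 (iv 9) (iv 10)) (iv 14))) <|
    accumulate (.add (.read 2 (iv 10) (.sub (iv 13) (iv 14))) (vv 4))) <|
  .setVal 2 (iv 10) (iv 13) (vv 5)

theorem WP.addPayments {O : Oracles} {B : ℕ} {R : Memory → Prop} {s : Memory} (j g : ℕ)
    (hj : s.idx 9 0 0 = j) (hg : s.idx 10 0 0 = g) (hB : s.idx 1 0 g + 1 ≤ B)
    (h5 : s.idx 5 = fun _ _ => 0)
    (h : ∀ s', Frame [12, 13, 14, 5] [2, 4, 5] s s' → s'.idx 5 = (fun _ _ => 0) →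
      (∀ i w, s'.val 2 i w = if i = g ∧ w ≤ s.idx 1 0 g then
        partialSups (fun u => s.val 2 g (w - u) + O.payment (single j g (s.idx 3 j g - u)) j)
          (min (s.idx 3 j g) w) else s.val 2 i w) → R s') :
    WP O B addPayments R s := by
  refine .forLt (s.idx 1 0 g + 1) hB (fun m s' => s'.idx 5 = (fun _ _ => 0) ∧
    ∀ i w, s'.val 2 i w = if i = g ∧ w ≤ s.idx 1 0 g ∧ s.idx 1 0 g < w + m then
        partialSups (fun u => s.val 2 g (w - u) + O.payment (single j g (s.idx 3 j g - u)) j)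
          (min (s.idx 3 j g) w) else s.val 2 i w)
    (by decide) ?_ ?_ ?_ ?_ ?_
  · intro s' hF
    simp [IdxExpr.eval, iv, hF.1 1 (by decide), hF.1 10 (by decide), hg]
  · intro m s' x hi
    simpa [write_of_ne] using hi
  · exact ⟨h5, fun i w => by rw [if_neg (by omega)]⟩
  · intro m hm s₁ hF hv ⟨hi5, hi⟩
    have e1 : s₁.idx 1 = s.idx 1 := hF.1 1 (by decide)
    have e3 : s₁.idx 3 = s.idx 3 := hF.1 3 (by decide)
    have e9 : s₁.idx 9 = s.idx 9 := hF.1 9 (by decide)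
    have e10 : s₁.idx 10 = s.idx 10 := hF.1 10 (by decide)
    -- The amounts `w` are treated in decreasing order: the update is in place, and the entries at
    -- `w - u` must still hold the old payoffs.
    set w := s.idx 1 0 g - m with hw
    set c := s.idx 3 j g with hc
    set G : ℕ → ℝ := fun u => s.val 2 g (w - u) + O.payment (single j g (c - u)) j with hG
    have hf : ∀ u, s₁.val 2 g (w - u) = s.val 2 g (w - u) := fun u => by
      rw [hi, if_neg (by omega)]
    refine .seq (.setIdx (.seq (.askPayment j g (by simp [write, e9, hj]) (by simp [write, e10, hg])
      (by simpa [write_of_ne] using hi5) fun s₂ hF₂ hp => .seq (.setVal (.seq ?_)))))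
    have e13 : s₂.idx 13 0 0 = w := by
      rw [hF₂.1 13 (by simp)]
      simp [write, IdxExpr.eval, iv, e1, e10, hg, hv, hw]
    have i2 : ∀ a, a ≠ 13 → s₂.idx a = s₁.idx a := fun a ha => by
      rw [hF₂.1 a (by simp)]
      exact write_of_ne ha _ _ _
    have v2 : s₂.val 2 = s₁.val 2 := hF₂.2 2 (by decide)
    rw [show IdxExpr.eval _ (.read 3 (iv 9) (iv 10)) = c by
      simp [IdxExpr.eval, iv, write, e3, e9, e10, hj, hg, hc]] at hp
    -- The accumulator starts at `G 0` and round `0` recomputes `G 0`, hence the truncated `m - 1`.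
    -- The bound in the program is `c - (c - w) = min c w`, plus one.
    refine .forLt (min c w + 1) ?_ (fun m s' => s'.idx 5 = (fun _ _ => 0) ∧
      s'.val 5 0 0 = partialSups G (m - 1)) (by decide) ?_ ?_ ?_ ?_ ?_
    · exact (Nat.succ_le_succ ((min_le_right _ _).trans (Nat.sub_le _ _))).trans hB
    · intro s' hF'
      simp only [IdxExpr.eval, iv, hF'.1 3 (by decide), hF'.1 9 (by decide), hF'.1 10 (by decide),
        hF'.1 13 (by decide), i2 3 (by decide), i2 9 (by decide), i2 10 (by decide), e3, e9, e10,
        e13, hj, hg]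
      rw [← hc]
      omega
    · intro m s' x hi
      simpa [write_of_ne] using hi
    · refine ⟨by simpa [i2] using hi5, ?_⟩
      have := hf 0
      rw [Nat.sub_zero] at this
      simp [write, ValExpr.eval, IdxExpr.eval, vv, iv, i2 10 (by decide), e10, hg, e13, v2, this,
        hp, hG]
    · rintro m' hm' s₃ hF₃ hv' ⟨h5', hx⟩
      have f3 : s₃.idx 3 = s.idx 3 := by rw [hF₃.1 3 (by decide), ← e3, ← i2 3 (by decide)]
      have f9 : s₃.idx 9 = s.idx 9 := by rw [hF₃.1 9 (by decide), ← e9, ← i2 9 (by decide)]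
      have f10 : s₃.idx 10 = s.idx 10 := by rw [hF₃.1 10 (by decide), ← e10, ← i2 10 (by decide)]
      have f13 : s₃.idx 13 0 0 = w := by rw [hF₃.1 13 (by decide), ← e13]
      have v3 : s₃.val 2 = s₁.val 2 := by
        rw [hF₃.2 2 (by decide), ← v2]
        simp [write_of_ne]
      refine .seq (.askPayment j g (by rw [f9, hj]) (by rw [f10, hg]) h5' fun s₄ hF₄ hp' =>
        .accumulate fun s₅ hF₅ hx' => ⟨?_, ?_⟩)
      · rw [hF₅.1 5 (by simp), hF₄.1 5 (by simp), h5']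
      · rw [hx', hF₄.2 5 (by simp), hx, Nat.add_sub_cancel, ← max_partialSups_pred G m']
        congr 1
        simp only [ValExpr.eval, IdxExpr.eval, iv, vv, hF₄.1 10 (by simp), hF₄.1 13 (by simp),
          hF₄.1 14 (by simp), hF₄.2 2 (by simp), f10, hg, f13, hv', v3, hf, hp', f3, f9, hj]
        rw [hG]
    · rintro s₃ hF₃ ⟨h5', hx⟩
      have f10 : s₃.idx 10 = s.idx 10 := by rw [hF₃.1 10 (by decide), ← e10, ← i2 10 (by decide)]
      have f13 : s₃.idx 13 0 0 = w := by rw [hF₃.1 13 (by decide), ← e13]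
      have v3 : s₃.val 2 = s₁.val 2 := by
        rw [hF₃.2 2 (by decide), ← v2]
        simp [write_of_ne]
      refine .setVal ⟨h5', fun i w' => ?_⟩
      simp only [write, IdxExpr.eval, ValExpr.eval, iv, vv, f10, hg, f13, v3, hi, hx, true_and,
        Nat.add_sub_cancel]
      by_cases hiw : i = g ∧ w' = w
      · obtain ⟨rfl, rfl⟩ := hiw
        rw [if_pos ⟨rfl, rfl⟩, if_pos ⟨rfl, by omega, by omega⟩]
      · rw [if_neg hiw]
        congr 1
        simp only [eq_iff_iff]
        constructor
        · rintro ⟨h1, h2, h3⟩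
          exact ⟨h1, h2, by omega⟩
        · rintro ⟨h1, h2, h3⟩
          have : w' ≠ w := fun h => hiw ⟨h1, h⟩
          exact ⟨h1, h2, by omega⟩
  · rintro s' hF ⟨hi5, hi⟩
    refine h s' (hF.mono (by decide) (by decide)) hi5 fun i w => ?_
    rw [hi]
    congr 1
    simp only [eq_iff_iff]
    constructor
    · rintro ⟨h1, h2, h3⟩
      exact ⟨h1, h2⟩
    · rintro ⟨h1, h2⟩
      exact ⟨h1, h2, by omega⟩

/-- Compute the payoffs that the agents obtain from the coalitions with nonmembers of the deviating
set. -/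
def outerPayments : Program :=
  forLt 9 (.read 0 (.const 0) (.const 1)) <|
  .seq findAgent (.cond (.idxLe (.const 1) (iv 11)) addPayments .skip)

/-- Each outer coalition is charged to exactly one agent and alters only that agent's row; the
others skip it, so every row solves its own knapsack problem. -/
theorem WP.outerPayments {O : Oracles} {B : ℕ} {R : Memory → Prop} {s : Memory} (n m : ℕ)
    (U : ℕ → ℕ) (agent : ℕ → ℕ) (outer : ℕ → Prop)
    (hn : s.idx 0 0 0 = n) (hm : s.idx 0 0 1 = m) (hnB : n ≤ B) (hmB : m ≤ B)
    (hU : s.idx 1 0 = U) (hUB : ∀ i, U i + 1 ≤ B) (h5 : s.idx 5 = fun _ _ => 0)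
    (hf : s.val 2 = fun _ _ => 0)
    (houter : ∀ j < m, outer j ↔ ∃ i < n, 0 < s.idx 3 j i ∧ s.idx 2 0 i = 0)
    (hagent : ∀ j < m, outer j → ∀ g, IsAgentOf n (s.idx 2 0) (s.idx 3 j) g → g = agent j)
    (h : ∀ s', Frame [5, 8, 9, 10, 11, 12, 13, 14] [2, 4, 5] s s' →
      (∀ i, ∀ w ≤ U i, IsGreatest (payments (fun j t => O.payment (single j i t) j)
        (fun j => s.idx 3 j i) ((Finset.range m).filter fun j => outer j ∧ agent j = i) w)
        (s'.val 2 i w)) → R s') :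
    WP O B outerPayments R s := by
  refine .forLt m hmB (fun m' s' => s'.idx 5 = (fun _ _ => 0) ∧
    ∀ i, ∀ w ≤ U i, IsGreatest (payments (fun j t => O.payment (single j i t) j)
        (fun j => s.idx 3 j i) ((Finset.range m').filter fun j => outer j ∧ agent j = i) w)
        (s'.val 2 i w)) (by decide) ?_ ?_ ?_ ?_ ?_
  · intro s' hF
    simp [IdxExpr.eval, hF.1 0 (by decide), hm]
  · intro m s' x hi
    simpa [write_of_ne] using hi
  · refine ⟨h5, fun i w _ => ?_⟩
    rw [hf]
    exact isGreatest_payments_empty _ _ _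
  · rintro j hj s₁ hF hv ⟨hi5, hi⟩
    have e0 : s₁.idx 0 = s.idx 0 := hF.1 0 (by decide)
    have e1 : s₁.idx 1 = s.idx 1 := hF.1 1 (by decide)
    have e2 : s₁.idx 2 = s.idx 2 := hF.1 2 (by decide)
    have e3 : s₁.idx 3 = s.idx 3 := hF.1 3 (by decide)
    refine .seq (.findAgent n j (by rw [e0, hn]) hv hnB fun s₂ hF₂ hg ho => ?_)
    rw [e2, e3] at hg ho
    rw [← houter j hj] at ho
    refine .cond (fun hb => ?_) (fun hb => .skip ⟨?_, fun i w hw => ?_⟩)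
    all_goals simp only [Test.holds, IdxExpr.eval, iv, ho] at hb
    · have hag := hagent j hj hb _ hg
      have i1 : s₂.idx 1 = s.idx 1 := by rw [hF₂.1 1 (by decide), e1]
      have i3 : s₂.idx 3 = s.idx 3 := by rw [hF₂.1 3 (by decide), e3]
      refine .addPayments j (agent j) (by rw [hF₂.1 9 (by decide), hv]) hag
        (by rw [i1, hU]; exact hUB _) (by rw [hF₂.1 5 (by decide), hi5]) fun s₃ hF₃ h5' hf' =>
        ⟨h5', fun i w hw => ?_⟩
      rw [hf', i1, hU, i3, hF₂.2 2 (by simp), Finset.range_add_one, Finset.filter_insert]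
      by_cases hij : i = agent j
      · subst hij
        rw [if_pos ⟨hb, rfl⟩, if_pos ⟨rfl, hw⟩]
        exact isGreatest_payments_insert (by simp) fun w' hw' => hi _ _ (hw'.trans hw)
      · rw [if_neg fun h => hij h.2.symm, if_neg fun h => hij h.1]
        exact hi _ _ hw
    · rw [hF₂.1 5 (by decide), hi5]
    · rw [hF₂.2 2 (by simp), Finset.range_add_one, Finset.filter_insert, if_neg fun h => hb h.1]
      exact hi i w hw
  · rintro s' hF ⟨-, hi⟩
    exact h s' (hF.mono (by decide) (by decide)) hi

/-! ### Detection of interacting pairs -/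

/-- Find out which pairs of agents can form a coalition of positive value. -/
def findEdges : Program :=
  forLt 8 (iv 0) <| forLt 9 (iv 0) <|
  forLt 14 (.read 1 (.const 0) (iv 8)) <| forLt 15 (.read 1 (.const 0) (iv 9)) <|
  .seq (askValue (iv 8) (iv 9) (.add (iv 14) (.const 1)) (.add (iv 15) (.const 1))) <|
  .cond (.valLe (vv 4) .zero) .skip (.setIdx 6 (iv 8) (iv 9) (.const 1))

theorem WP.findEdges {O : Oracles} {B : ℕ} {R : Memory → Prop} {s : Memory} (n : ℕ) (U : ℕ → ℕ)
    (hn : s.idx 0 0 0 = n) (hnB : n ≤ B) (hU : s.idx 1 0 = U) (hUB : ∀ i, U i ≤ B)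
    (h4 : s.idx 4 = fun _ _ => 0) (h6 : s.idx 6 = fun _ _ => 0)
    (h : ∀ s', Frame [4, 6, 8, 9, 14, 15] [4] s s' → s'.idx 4 = (fun _ _ => 0) →
      (∀ i < n, ∀ k < n, 0 < s'.idx 6 i k ↔
        ∃ u w, u < U i ∧ w < U k ∧ 0 < O.value (pairRow i k (u + 1) (w + 1))) → R s') :
    WP O B findEdges R s := by
  -- `X` collects the quadruples already visited; in the four nested loops it is an initial segment
  -- of the lexicographic order.
  let E (X : ℕ → ℕ → ℕ → ℕ → Prop) (s' : Memory) : Prop :=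
    s'.idx 4 = (fun _ _ => 0) ∧ ∀ i < n, ∀ k < n, 0 < s'.idx 6 i k ↔
      ∃ u w, X i k u w ∧ u < U i ∧ w < U k ∧ 0 < O.value (pairRow i k (u + 1) (w + 1))
  have hE : ∀ {X X' : ℕ → ℕ → ℕ → ℕ → Prop} {s' : Memory}, E X s' →
      (∀ i k u w, k < n → u < U i → w < U k → (X i k u w ↔ X' i k u w)) → E X' s' := by
    intro X X' s' hX hXX'
    refine ⟨hX.1, fun i hi k hk => (hX.2 i hi k hk).trans ?_⟩
    constructor
    · rintro ⟨u, w, h1, h2, h3, h4⟩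
      exact ⟨u, w, (hXX' i k u w hk h2 h3).1 h1, h2, h3, h4⟩
    · rintro ⟨u, w, h1, h2, h3, h4⟩
      exact ⟨u, w, (hXX' i k u w hk h2 h3).2 h1, h2, h3, h4⟩
  have hEi : ∀ {X : ℕ → ℕ → ℕ → ℕ → Prop} {s' : Memory} (v x : ℕ), v ≠ 4 → v ≠ 6 → E X s' →
      E X { s' with idx := write s'.idx v 0 0 x } := by
    intro X s' v x hv4 hv6 hX
    refine ⟨?_, fun i hi k hk => ?_⟩
    · rw [← hX.1]; exact write_of_ne hv4.symm _ _ _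
    · rw [← hX.2 i hi k hk]; simp [write_of_ne hv6.symm]
  refine .forLt n hnB (fun m => E fun i _ _ _ => i < m) (by decide) ?_
    (fun m s' x => hEi _ _ (by decide) (by decide)) ⟨h4, by simp [h6]⟩ ?_ ?_
  · intro s' hF
    simp [IdxExpr.eval, iv, hF.1 0 (by decide), hn]
  · intro i₀ hi₀ s₁ hF₁ hv₁ hi₁
    have n₁ : s₁.idx 0 = s.idx 0 := hF₁.1 0 (by decide)
    have u₁ : s₁.idx 1 = s.idx 1 := hF₁.1 1 (by decide)
    refine .forLt n hnB (fun m => E fun i k _ _ => i < i₀ ∨ i = i₀ ∧ k < m) (by decide) ?_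
      (fun m s' x => hEi _ _ (by decide) (by decide)) (hE hi₁ (by simp)) ?_
      (fun s' _ hi => hE hi ?_)
    · intro s' hF
      simp [IdxExpr.eval, iv, hF.1 0 (by decide), n₁, hn]
    · intro k₀ hk₀ s₂ hF₂ hv₂ hi₂
      have u₂ : s₂.idx 1 = s.idx 1 := by rw [hF₂.1 1 (by decide), u₁]
      have a₂ : s₂.idx 8 0 0 = i₀ := by rw [hF₂.1 8 (by decide), hv₁]
      refine .forLt (U i₀) (hUB _)
        (fun m => E fun i k u _ => i < i₀ ∨ i = i₀ ∧ (k < k₀ ∨ k = k₀ ∧ u < m)) (by decide) ?_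
        (fun m s' x => hEi _ _ (by decide) (by decide)) (hE hi₂ (by simp)) ?_
        (fun s' _ hi => hE hi ?_)
      · intro s' hF
        simp [IdxExpr.eval, iv, hF.1 1 (by decide), hF.1 8 (by decide), u₂, a₂, hU]
      · intro u₀ hu₀ s₃ hF₃ hv₃ hi₃
        have u₃ : s₃.idx 1 = s.idx 1 := by rw [hF₃.1 1 (by decide), u₂]
        have a₃ : s₃.idx 8 0 0 = i₀ := by rw [hF₃.1 8 (by decide), a₂]
        have b₃ : s₃.idx 9 0 0 = k₀ := by rw [hF₃.1 9 (by decide), hv₂]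
        refine .forLt (U k₀) (hUB _) (fun m => E fun i k u w =>
          i < i₀ ∨ i = i₀ ∧ (k < k₀ ∨ k = k₀ ∧ (u < u₀ ∨ u = u₀ ∧ w < m))) (by decide) ?_
          (fun m s' x => hEi _ _ (by decide) (by decide)) (hE hi₃ (by simp)) ?_
          (fun s' _ hi => hE hi ?_)
        · intro s' hF
          simp [IdxExpr.eval, iv, hF.1 1 (by decide), hF.1 9 (by decide), u₃, b₃, hU]
        · intro w₀ hw₀ s₄ hF₄ hv₄ hi₄
          have a₄ : s₄.idx 8 0 0 = i₀ := by rw [hF₄.1 8 (by decide), a₃]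
          have b₄ : s₄.idx 9 0 0 = k₀ := by rw [hF₄.1 9 (by decide), b₃]
          have c₄ : s₄.idx 14 0 0 = u₀ := by rw [hF₄.1 14 (by decide), hv₃]
          refine .seq (.askValue i₀ k₀ (u₀ + 1) (w₀ + 1) ?_ ?_ ?_ ?_ hi₄.1 fun s₅ hF₅ hp => ?_)
          · intro s' hF; simp [IdxExpr.eval, iv, hF.1 8 (by decide), a₄]
          · intro s' hF; simp [IdxExpr.eval, iv, hF.1 9 (by decide), b₄]
          · intro s' hF; simp [IdxExpr.eval, iv, hF.1 14 (by decide), c₄]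
          · intro s' hF; simp [IdxExpr.eval, iv, hF.1 15 (by decide), hv₄]
          · have e4 := hF₅.1 4 (by simp)
            have e6 := hF₅.1 6 (by simp)
            have e8 := hF₅.1 8 (by simp)
            have e9 := hF₅.1 9 (by simp)
            refine .cond (fun hb => .skip ?_) (fun hb => .setIdx ?_)
            all_goals
              simp only [Test.holds, ValExpr.eval, IdxExpr.eval, vv, hp, not_le] at hb
            · refine ⟨by rw [e4, hi₄.1], fun i hi k hk => ?_⟩
              rw [e6, hi₄.2 i hi k hk]
              constructor
              · rintro ⟨u, w, h1, h2⟩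
                exact ⟨u, w, by omega, h2⟩
              · rintro ⟨u, w, h1, h2, h3, h4⟩
                refine ⟨u, w, ?_, h2, h3, h4⟩
                by_contra h5
                obtain ⟨rfl, rfl, rfl, rfl⟩ : i = i₀ ∧ k = k₀ ∧ u = u₀ ∧ w = w₀ := by omega
                exact absurd hb (not_le.2 h4)
            · refine ⟨?_, fun i hi k hk => ?_⟩
              · rw [← hi₄.1, ← e4]; simp [write_of_ne]
              · simp only [write, IdxExpr.eval, iv, e8, e9, a₄, b₄, true_and]
                split_ifs with hik
                · obtain ⟨rfl, rfl⟩ := hik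
                  exact ⟨fun _ => ⟨u₀, w₀, by omega, hu₀, hw₀, hb⟩, fun _ => by omega⟩
                · rw [e6, hi₄.2 i hi k hk]
                  constructor
                  · rintro ⟨u, w, h1, h2⟩
                    exact ⟨u, w, by omega, h2⟩
                  · rintro ⟨u, w, h1, h2⟩
                    exact ⟨u, w, by omega, h2⟩
        · intro i k u w _ _ hw
          constructor
          · omega
          · rintro (h | ⟨rfl, h | ⟨rfl, h⟩⟩) <;> omega
      · intro i k u w _ hu _
        constructor
        · omega
        · rintro (h | ⟨rfl, h⟩) <;> omega
    · intro i k u w hk _ _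
      constructor
      · omega
      · rintro h; omega
  · rintro s' hF ⟨h4', hi⟩
    refine h s' (hF.mono (by decide) (by decide)) h4' fun i hi' k hk => (hi i hi' k hk).trans ?_
    simp [hi']

/-! ### Search for an agent with at most one partner -/

/-- `i` and `k` can form a coalition of positive value, and `i` is not eliminated. -/
def IsNeighbour (D : ℕ → ℕ) (E : ℕ → ℕ → ℕ) (k i : ℕ) : Prop :=
  D i = 0 ∧ 0 < E i k ∧ i ≠ k

/-- Count the neighbours of the agent in register `8`; register `18` is one of them, or the dummy
agent `n` if there is none, and register `19` is positive if there are several. -/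
def findParent : Program :=
  .seq (.setIdx 18 (.const 0) (.const 0) (iv 0)) <|
  .seq (.setIdx 19 (.const 0) (.const 0) (.const 0)) <|
  forLt 9 (iv 0) <|
  .cond (.and (.idxLe (.read 7 (.const 0) (iv 9)) (.const 0))
      (.and (.idxLe (.const 1) (.read 6 (iv 9) (iv 8)))
        (.not (.and (.idxLe (iv 9) (iv 8)) (.idxLe (iv 8) (iv 9))))))
    (.cond (.idxLe (iv 0) (iv 18)) (.setIdx 18 (.const 0) (.const 0) (iv 9))
      (.setIdx 19 (.const 0) (.const 0) (.const 1)))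
    .skip

/-- The first neighbour met is kept, and any further one only raises the flag. So a zero flag
certifies uniqueness, and a positive flag two distinct neighbours. -/
theorem WP.findParent {O : Oracles} {B : ℕ} {R : Memory → Prop} {s : Memory} (n k : ℕ)
    (hn : s.idx 0 0 0 = n) (hk : s.idx 8 0 0 = k) (hnB : n ≤ B)
    (h : ∀ s', Frame [9, 18, 19] [] s s' →
      (s'.idx 18 0 0 = n ∨ s'.idx 18 0 0 < n ∧
        IsNeighbour (s.idx 7 0) (s.idx 6) k (s'.idx 18 0 0)) →
      (s'.idx 19 0 0 = 0 → ∀ i < n, IsNeighbour (s.idx 7 0) (s.idx 6) k i → i = s'.idx 18 0 0) →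
      (0 < s'.idx 19 0 0 → ∃ i < n, ∃ i' < n, IsNeighbour (s.idx 7 0) (s.idx 6) k i ∧
        IsNeighbour (s.idx 7 0) (s.idx 6) k i' ∧ i ≠ i') → R s') :
    WP O B findParent R s := by
  refine .seq (.setIdx (.seq (.setIdx ?_)))
  generalize hs₀ : Memory.mk _ _ = s₀
  have hF₀ : Frame [18, 19] [] s s₀ := by
    subst hs₀
    constructor
    · intro a ha
      simp only [List.mem_cons, List.not_mem_nil, or_false, not_or] at ha
      simp [write_of_ne, ha]
    · simp
  have h18 : s₀.idx 18 0 0 = n := by subst hs₀; simp [write, IdxExpr.eval, iv, hn]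
  have h19 : s₀.idx 19 0 0 = 0 := by subst hs₀; simp [write, IdxExpr.eval]
  clear hs₀
  set N := IsNeighbour (s.idx 7 0) (s.idx 6) k with hN
  refine .forLt n hnB (fun m s' =>
    ((s'.idx 18 0 0 = n ∧ s'.idx 19 0 0 = 0 ∧ ∀ i < m, ¬ N i) ∨
      (s'.idx 18 0 0 < n ∧ s'.idx 18 0 0 < m ∧ N (s'.idx 18 0 0))) ∧
    (s'.idx 19 0 0 = 0 → ∀ i < m, N i → i = s'.idx 18 0 0) ∧
    (0 < s'.idx 19 0 0 → ∃ i < n, ∃ i' < n, N i ∧ N i' ∧ i ≠ i'))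
    (by decide) ?_ ?_ (by simp [h18, h19]) ?_ ?_
  · intro s' hF
    simp [IdxExpr.eval, iv, hF.1 0 (by decide), hF₀.1 0 (by decide), hn]
  · intro m s' x hi
    simpa [write_of_ne] using hi
  · rintro m hm s' hF hv ⟨hi, hi', hi''⟩
    have e0 : s'.idx 0 = s.idx 0 := (hF.1 0 (by decide)).trans (hF₀.1 0 (by decide))
    have e6 : s'.idx 6 = s.idx 6 := (hF.1 6 (by decide)).trans (hF₀.1 6 (by decide))
    have e7 : s'.idx 7 = s.idx 7 := (hF.1 7 (by decide)).trans (hF₀.1 7 (by decide))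
    have e8 : s'.idx 8 = s.idx 8 := (hF.1 8 (by decide)).trans (hF₀.1 8 (by decide))
    have hNm : (s.idx 7 0 m ≤ 0 ∧ 1 ≤ s.idx 6 m k ∧ ¬ (m ≤ k ∧ k ≤ m)) ↔ N m := by
      simp only [hN, IsNeighbour]
      omega
    refine .cond (fun hb => .cond (fun hb' => .setIdx ?_) (fun hb' => .setIdx ?_))
      (fun hb => .skip ?_)
    all_goals
      simp only [Test.holds, IdxExpr.eval, iv, hv, e6, e7, e8, hk, hNm] at hb
    · simp only [Test.holds, IdxExpr.eval, iv, e0, hn] at hb'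
      simp only [write, IdxExpr.eval, iv, hv]
      grind
    · simp only [Test.holds, IdxExpr.eval, iv, e0, hn] at hb'
      obtain ⟨h1, h2, h3⟩ := hi.resolve_left fun h => hb' h.1.ge
      simp only [write, IdxExpr.eval, and_self, if_true, Nat.reduceEqDiff, false_and, if_false]
      exact ⟨Or.inr ⟨h1, by omega, h3⟩, by simp, fun _ => ⟨_, h1, m, hm, h3, hb, by omega⟩⟩
    · grind
  · rintro s' hF ⟨hi, hi', hi''⟩
    refine h s' ((hF₀.mono (by decide) (by decide)).trans (hF.mono (by decide) (by decide)))
      ?_ hi' hi''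
    rcases hi with hi | hi
    · exact Or.inl hi.1
    · exact Or.inr ⟨hi.1, hi.2.2⟩

/-- Find an agent with at most one neighbour, and its neighbour or the dummy agent `n`. -/
def findLeaf : Program :=
  forLt 8 (iv 0) <|
  .cond (.idxLe (.read 7 (.const 0) (iv 8)) (.const 0))
    (.seq findParent <| .cond (.idxLe (iv 19) (.const 0))
      (.seq (.setIdx 16 (.const 0) (.const 0) (iv 8)) (.setIdx 17 (.const 0) (.const 0) (iv 18)))
      .skip)
    .skip

theorem WP.findLeaf {O : Oracles} {B : ℕ} {R : Memory → Prop} {s : Memory} (n : ℕ)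
    (hn : s.idx 0 0 0 = n) (hnB : n ≤ B)
    (hleaf : ∃ k < n, s.idx 7 0 k = 0 ∧ ∀ i < n, ∀ i' < n,
      IsNeighbour (s.idx 7 0) (s.idx 6) k i → IsNeighbour (s.idx 7 0) (s.idx 6) k i' → i = i')
    (h : ∀ s', Frame [8, 9, 16, 17, 18, 19] [] s s' → ∀ k p, s'.idx 16 0 0 = k →
      s'.idx 17 0 0 = p → k < n → s.idx 7 0 k = 0 →
      (p = n ∨ p < n ∧ IsNeighbour (s.idx 7 0) (s.idx 6) k p) →
      (∀ i < n, IsNeighbour (s.idx 7 0) (s.idx 6) k i → i = p) → R s') :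
    WP O B findLeaf R s := by
  obtain ⟨k₀, hk₀n, hk₀, hleaf⟩ := hleaf
  let Good (k p : ℕ) : Prop := k < n ∧ s.idx 7 0 k = 0 ∧
      (p = n ∨ p < n ∧ IsNeighbour (s.idx 7 0) (s.idx 6) k p) ∧
      ∀ i < n, IsNeighbour (s.idx 7 0) (s.idx 6) k i → i = p
  -- The search does not stop at the first success. Registers `16` and `17` are only ever
  -- overwritten by good pairs, and they hold one as soon as `k₀` has been passed.
  refine .forLt n hnB (fun m s' => k₀ < m → Good (s'.idx 16 0 0) (s'.idx 17 0 0)) (by decide)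
    ?_ ?_ (by simp) ?_ ?_
  · intro s' hF
    simp [IdxExpr.eval, iv, hF.1 0 (by decide), hn]
  · intro m s' x hi
    simpa [write_of_ne] using hi
  · intro m hm s' hF hv hi
    have e0 : s'.idx 0 = s.idx 0 := hF.1 0 (by decide)
    have e6 : s'.idx 6 = s.idx 6 := hF.1 6 (by decide)
    have e7 : s'.idx 7 = s.idx 7 := hF.1 7 (by decide)
    refine .cond (fun hb => .seq (.findParent n m (by rw [e0, hn]) hv hnB
      fun s₁ hF₁ h1 h2 h3 => ?_)) (fun hb => .skip fun hlt => hi ?_)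
    all_goals simp only [Test.holds, IdxExpr.eval, iv, hv, e7, Nat.le_zero] at hb
    · rw [e6, e7] at h1 h2 h3
      refine .cond (fun hb' => .seq (.setIdx (.setIdx fun _ => ?_))) (fun hb' => .skip fun hlt => ?_)
      all_goals simp only [Test.holds, IdxExpr.eval, iv, Nat.le_zero] at hb'
      · simpa [write, IdxExpr.eval, iv, hF₁.1 8 (by decide), hv] using ⟨hm, hb, h1, h2 hb'⟩
      · rw [hF₁.1 16 (by decide), hF₁.1 17 (by decide)]
        refine hi (lt_of_le_of_ne (Nat.lt_succ_iff.1 hlt) ?_)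
        rintro rfl
        obtain ⟨i, hin, i', hin', hii, hii', hne⟩ := h3 (Nat.pos_of_ne_zero hb')
        exact hne (hleaf i hin i' hin' hii hii')
    · refine lt_of_le_of_ne (Nat.lt_succ_iff.1 hlt) ?_
      rintro rfl
      exact hb hk₀
  · rintro s' hF hi
    obtain ⟨h1, h2, h3, h4⟩ := hi hk₀n
    exact h s' (hF.mono (by decide) (by decide)) _ _ rfl rfl h1 h2 h3 h4

/-! ### The payoff table of a pair -/

/-- Compute the best total payoff for the resources in registers `12` and `13` from the previous
ones. -/
def fillCell : Program :=
  forLt 14 (.add (iv 12) (.const 1)) <| forLt 15 (.add (iv 13) (.const 1)) <|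
  .cond (.idxLe (.const 1) (.add (iv 14) (iv 15)))
    (.seq (askValue (iv 17) (iv 16) (iv 14) (iv 15)) <|
      accumulate (.add (.read 3 (.sub (iv 12) (iv 14)) (.sub (iv 13) (iv 15))) (vv 4)))
    .skip

/-- Compute the best total payoffs of the agents in registers `17` and `16`. -/
def fillPair : Program :=
  forLt 12 (.add (.read 1 (.const 0) (iv 17)) (.const 1)) <|
  forLt 13 (.add (.read 1 (.const 0) (iv 16)) (.const 1)) <|
  .seq (.setVal 5 (.const 0) (.const 0) (.add (.read 2 (iv 17) (iv 12)) (.read 2 (iv 16) (iv 13)))) <|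
  .seq fillCell <|
  .setVal 3 (iv 12) (iv 13) (vv 5)

theorem pairCandidates_congr {val : (ℕ → ℕ) → ℝ} {p k : ℕ} {f H : ℕ → ℕ → ℝ} {a b : ℕ}
    {X X' : ℕ → ℕ → Prop} (h : ∀ u w, u ≤ a → w ≤ b → 0 < u + w → (X u w ↔ X' u w)) :
    pairCandidates val p k f H a b X = pairCandidates val p k f H a b X' := by
  ext r
  refine or_congr_right (exists_congr fun u => exists_congr fun w => ?_)
  constructor <;> rintro ⟨h1, h2, h3, h4, h5⟩
  · exact ⟨(h u w h2 h3 h4).1 h1, h2, h3, h4, h5⟩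
  · exact ⟨(h u w h2 h3 h4).2 h1, h2, h3, h4, h5⟩

theorem WP.fillCell {O : Oracles} {B : ℕ} {R : Memory → Prop} {s : Memory} (p k a b : ℕ)
    (hp : s.idx 17 0 0 = p) (hk : s.idx 16 0 0 = k)
    (ha : s.idx 12 0 0 = a) (hb : s.idx 13 0 0 = b) (haB : a + 1 ≤ B) (hbB : b + 1 ≤ B)
    (h4 : s.idx 4 = fun _ _ => 0) (h5 : s.val 5 0 0 = s.val 2 p a + s.val 2 k b)
    (h : ∀ s', Frame [4, 14, 15] [4, 5] s s' → s'.idx 4 = (fun _ _ => 0) →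
      IsGreatest (pairCandidates O.value p k (s.val 2) (s.val 3) a b fun _ _ => True)
        (s'.val 5 0 0) → R s') :
    WP O B fillCell R s := by
  -- `X` consists of the contributions `(u, w)` tried so far. For empty `X` the only candidate is to
  -- form no coalition, with which the accumulator starts.
  let C (X : ℕ → ℕ → Prop) (s' : Memory) : Prop := s'.idx 4 = (fun _ _ => 0) ∧
    IsGreatest (pairCandidates O.value p k (s.val 2) (s.val 3) a b X) (s'.val 5 0 0)
  have hC : ∀ {X X' : ℕ → ℕ → Prop} {s' : Memory}, C X s' →
      (∀ u w, u ≤ a → w ≤ b → 0 < u + w → (X u w ↔ X' u w)) → C X' s' :=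
    fun {X X' s'} hX h => ⟨hX.1, pairCandidates_congr h ▸ hX.2⟩
  have hCi : ∀ {X : ℕ → ℕ → Prop} {s' : Memory} (v x : ℕ), v ≠ 4 → C X s' →
      C X { s' with idx := write s'.idx v 0 0 x } := fun {X s'} v x hv hX =>
    ⟨(write_of_ne hv.symm _ _ _).trans hX.1, hX.2⟩
  refine .forLt (a + 1) haB (fun m => C fun u _ => u < m) (by decide) ?_
    (fun m s' x => hCi _ _ (by decide)) ⟨h4, ?_⟩ ?_ fun s' hF hi => ?_
  · intro s' hF
    simp [IdxExpr.eval, iv, hF.1 12 (by decide), ha]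
  · rw [h5]
    refine ⟨Or.inl rfl, ?_⟩
    rintro r (rfl | ⟨u, w, h, -⟩)
    · exact le_rfl
    · exact absurd h (Nat.not_lt_zero _)
  · intro u₀ hu₀ s₁ hF₁ hv₁ hi₁
    refine .forLt (b + 1) hbB (fun m => C fun u w => u < u₀ ∨ u = u₀ ∧ w < m) (by decide) ?_
      (fun m s' x => hCi _ _ (by decide)) (hC hi₁ (by simp)) ?_ fun s' hF hi => hC hi ?_
    · intro s' hF
      simp [IdxExpr.eval, iv, hF.1 13 (by decide), hF₁.1 13 (by decide), hb]
    · intro w₀ hw₀ s₂ hF₂ hv₂ hi₂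
      have e12 : s₂.idx 12 0 0 = a := by rw [hF₂.1 12 (by decide), hF₁.1 12 (by decide), ha]
      have e13 : s₂.idx 13 0 0 = b := by rw [hF₂.1 13 (by decide), hF₁.1 13 (by decide), hb]
      have e14 : s₂.idx 14 0 0 = u₀ := by rw [hF₂.1 14 (by decide), hv₁]
      have e16 : s₂.idx 16 0 0 = k := by rw [hF₂.1 16 (by decide), hF₁.1 16 (by decide), hk]
      have e17 : s₂.idx 17 0 0 = p := by rw [hF₂.1 17 (by decide), hF₁.1 17 (by decide), hp]
      have v3 : s₂.val 3 = s.val 3 := by rw [hF₂.2 3 (by decide), hF₁.2 3 (by decide)]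
      refine .cond (fun hb => .seq ?_) (fun hb => .skip (hC hi₂ fun u w h1 h2 h3 => ?_))
      all_goals simp only [Test.holds, IdxExpr.eval, iv, e14, hv₂] at hb
      · refine .askValue p k u₀ w₀ ?_ ?_ ?_ ?_ hi₂.1 fun s₃ hF₃ hr =>
          .accumulate fun s₄ hF₄ hx => ⟨?_, ?_⟩
        · intro s' hF; simp [IdxExpr.eval, iv, hF.1 17 (by decide), e17]
        · intro s' hF; simp [IdxExpr.eval, iv, hF.1 16 (by decide), e16]
        · intro s' hF; simp [IdxExpr.eval, iv, hF.1 14 (by decide), e14]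
        · intro s' hF; simp [IdxExpr.eval, iv, hF.1 15 (by decide), hv₂]
        · rw [hF₄.1 4 (by simp), hF₃.1 4 (by simp), hi₂.1]
        · have hx' : s₄.val 5 0 0 = max (s₂.val 5 0 0)
              (s.val 3 (a - u₀) (b - w₀) + O.value (pairRow p k u₀ w₀)) := by
            rw [hx, hF₃.2 5 (by simp)]
            simp [ValExpr.eval, IdxExpr.eval, iv, vv, hF₃.1 12 (by simp), hF₃.1 13 (by simp),
              hF₃.1 14 (by simp), hF₃.1 15 (by simp), hF₃.2 3 (by simp), e12, e13, e14, hv₂, v3, hr]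
          rw [hx', max_comm]
          refine (?_ : pairCandidates _ _ _ _ _ _ _ _ = insert _ (pairCandidates _ _ _ _ _ _ _
            fun u w => u < u₀ ∨ u = u₀ ∧ w < w₀)) ▸ hi₂.2.insert _
          ext r
          rw [Set.mem_insert_iff]
          constructor
          · rintro (h | ⟨u, w, h1, h2, h3, h4, h5⟩)
            · exact Or.inr (Or.inl h)
            · by_cases huw : u = u₀ ∧ w = w₀
              · obtain ⟨rfl, rfl⟩ := huw
                exact Or.inl h5
              · exact Or.inr (Or.inr ⟨u, w, by omega, h2, h3, h4, h5⟩)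
          · rintro (h | h | ⟨u, w, h1, h2⟩)
            · exact Or.inr ⟨u₀, w₀, by omega, by omega, by omega, by omega, h⟩
            · exact Or.inl h
            · exact Or.inr ⟨u, w, by omega, h2⟩
      · omega
    · intro u w _ hw _
      omega
  · exact h s' (hF.mono (by decide) (by decide)) hi.1
      (hC hi fun u w hu _ _ => by simpa using Nat.lt_succ_of_le hu).2

/-- Cells are filled row by row. A nonzero coalition leads from `(a, b)` to a cell with no larger
coordinates and smaller sum, which is already final. -/
theorem WP.fillPair {O : Oracles} {B : ℕ} {R : Memory → Prop} {s : Memory} (p k : ℕ) (U : ℕ → ℕ)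
    (hp : s.idx 17 0 0 = p) (hk : s.idx 16 0 0 = k) (hpk : p ≠ k)
    (hU : s.idx 1 0 = U) (hUB : ∀ i, U i + 1 ≤ B) (hO : O.value 0 = 0)
    (h4 : s.idx 4 = fun _ _ => 0)
    (h : ∀ s', Frame [4, 12, 13, 14, 15] [3, 4, 5] s s' → s'.idx 4 = (fun _ _ => 0) →
      (∀ a ≤ U p, ∀ b ≤ U k, IsBestPair O.value p k (s.val 2) a b (s'.val 3 a b)) → R s') :
    WP O B fillPair R s := by
  refine .forLt (U p + 1) (hUB p) (fun m s' => s'.idx 4 = (fun _ _ => 0) ∧ ∀ a b, a < m →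
    b ≤ U k → IsBestPair O.value p k (s.val 2) a b (s'.val 3 a b)) (by decide) ?_ ?_
    ⟨h4, by simp⟩ ?_ ?_
  · intro s' hF
    simp [IdxExpr.eval, iv, hF.1 1 (by decide), hF.1 17 (by decide), hp, hU]
  · intro m s' x hi
    simpa [write_of_ne] using hi
  · intro a₀ ha₀ s₁ hF₁ hv₁ hi₁
    refine .forLt (U k + 1) (hUB k) (fun m s' => s'.idx 4 = (fun _ _ => 0) ∧ ∀ a b,
      (a < a₀ ∨ a = a₀ ∧ b < m) → b ≤ U k →
      IsBestPair O.value p k (s.val 2) a b (s'.val 3 a b)) (by decide) ?_ ?_ ?_ ?_ ?_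
    · intro s' hF
      simp [IdxExpr.eval, iv, hF.1 1 (by decide), hF.1 16 (by decide), hF₁.1 1 (by decide),
        hF₁.1 16 (by decide), hk, hU]
    · intro m s' x hi
      simpa [write_of_ne] using hi
    · exact ⟨hi₁.1, fun a b h hb => hi₁.2 a b (by omega) hb⟩
    · intro b₀ hb₀ s₂ hF₂ hv₂ hi₂
      have e12 : s₂.idx 12 0 0 = a₀ := by rw [hF₂.1 12 (by decide), hv₁]
      have e16 : s₂.idx 16 0 0 = k := by rw [hF₂.1 16 (by decide), hF₁.1 16 (by decide), hk]
      have e17 : s₂.idx 17 0 0 = p := by rw [hF₂.1 17 (by decide), hF₁.1 17 (by decide), hp]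
      have v2 : s₂.val 2 = s.val 2 := by rw [hF₂.2 2 (by decide), hF₁.2 2 (by decide)]
      refine .seq (.setVal (.seq ?_))
      refine .fillCell p k a₀ b₀ e17 e16 e12 hv₂ (by have := hUB p; omega)
        (by have := hUB k; omega) hi₂.1 ?_ fun s₃ hF₃ h4' hg => .setVal ⟨h4', fun a b hab hb => ?_⟩
      · simp [write, ValExpr.eval, IdxExpr.eval, iv, e12, e16, e17, hv₂]
      · have w2 : ∀ x, write s₂.val 5 0 0 x 2 = s.val 2 := fun x => by
          rw [← v2]; simp [write_of_ne]
        have w3 : ∀ x, write s₂.val 5 0 0 x 3 = s₂.val 3 := fun x => by simp [write_of_ne]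
        simp only [IdxExpr.eval] at hg hF₃
        have u3 : s₃.val 3 = s₂.val 3 := by
          rw [hF₃.2 3 (by decide)]; simp [write_of_ne]
        rw [w2, w3] at hg
        simp only [write, IdxExpr.eval, ValExpr.eval, iv, vv, hF₃.1 12 (by decide),
          hF₃.1 13 (by decide), e12, hv₂, u3, true_and]
        split_ifs with hab'
        · obtain ⟨rfl, rfl⟩ := hab'
          refine isBestPair_of_isGreatest hO hpk (fun a' ha' b' hb' hlt => ?_) hg
          exact hi₂.2 a' b' (by omega) (by omega)
        · exact hi₂.2 a b (by omega) hb
    · rintro s' hF hi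
      exact ⟨hi.1, fun a b hab hb => hi.2 a b (by omega) hb⟩
  · rintro s' hF hi
    exact h s' (hF.mono (by decide) (by decide)) hi.1 fun a ha b hb => hi.2 a b (by omega) hb

/-- Eliminate the agent in register `16`, leaving the deal to the one in register `17`. -/
def absorb : Program :=
  .seq fillPair <|
  .seq (forLt 12 (.add (.read 1 (.const 0) (iv 17)) (.const 1)) <|
    .setVal 2 (iv 17) (iv 12) (.read 3 (iv 12) (.read 1 (.const 0) (iv 16)))) <|
  .setIdx 7 (.const 0) (iv 16) (.const 1)

/-- Only the column `b = U k` is copied, since the eliminated agent brings all its resources.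
Copying comes after the table is complete because the table reads the old payoffs of `p`. -/
theorem WP.absorb {O : Oracles} {B : ℕ} {R : Memory → Prop} {s : Memory} (p k : ℕ) (U : ℕ → ℕ)
    (hp : s.idx 17 0 0 = p) (hk : s.idx 16 0 0 = k) (hpk : p ≠ k)
    (hU : s.idx 1 0 = U) (hUB : ∀ i, U i + 1 ≤ B) (hO : O.value 0 = 0)
    (h4 : s.idx 4 = fun _ _ => 0)
    (h : ∀ s', Frame [4, 7, 12, 13, 14, 15] [2, 3, 4, 5] s s' → s'.idx 4 = (fun _ _ => 0) →
      (∀ i, s'.idx 7 0 i = if i = k then 1 else s.idx 7 0 i) →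
      (∀ i, i ≠ p → s'.val 2 i = s.val 2 i) →
      (∀ a ≤ U p, IsBestPair O.value p k (s.val 2) a (U k) (s'.val 2 p a)) → R s') :
    WP O B absorb R s := by
  refine .seq (.fillPair p k U hp hk hpk hU hUB hO h4 fun s₁ hF₁ h4' hH => .seq ?_)
  have e1 : s₁.idx 1 0 = U := by rw [hF₁.1 1 (by decide), hU]
  have e16 : s₁.idx 16 0 0 = k := by rw [hF₁.1 16 (by decide), hk]
  have e17 : s₁.idx 17 0 0 = p := by rw [hF₁.1 17 (by decide), hp]
  refine .forLt (U p + 1) (hUB p) (fun m s' => (∀ i, i ≠ p → s'.val 2 i = s.val 2 i) ∧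
    ∀ a < m, s'.val 2 p a = s₁.val 3 a (U k)) (by decide) ?_ ?_ ?_ ?_ ?_
  · intro s' hF
    simp [IdxExpr.eval, iv, hF.1 1 (by decide), hF.1 17 (by decide), e1, e17]
  · intro m s' x hi
    exact hi
  · exact ⟨fun i _ => by rw [hF₁.2 2 (by decide)], by simp⟩
  · rintro m hm s₂ hF₂ hv ⟨hi, hi'⟩
    refine .setVal ⟨fun i hip => ?_, fun a ha => ?_⟩
    · rw [← hi i hip]
      funext w
      simp [write, IdxExpr.eval, iv, hF₂.1 17 (by decide), e17, hip]
    · simp only [write, IdxExpr.eval, ValExpr.eval, iv, hF₂.1 17 (by decide), e17, hv, true_and,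
        hF₂.1 1 (by decide), hF₂.1 16 (by decide), hF₂.2 3 (by decide), e1, e16]
      split_ifs with ham
      · rw [ham]
      · exact hi' a (by omega)
  · rintro s₂ hF₂ ⟨hi, hi'⟩
    refine .setIdx (h _ ?_ ?_ ?_ hi ?_)
    · refine (hF₁.mono (by decide) (by decide)).trans
        ((hF₂.mono (by decide) (by decide)).trans ⟨fun a ha => write_of_ne ?_ _ _ _, fun _ _ => rfl⟩)
      rintro rfl
      exact ha (by decide)
    · rw [← h4', ← hF₂.1 4 (by decide)]
      simp [write_of_ne]
    · intro i
      simp [write, IdxExpr.eval, iv, hF₂.1 7 (by decide), hF₁.1 7 (by decide),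
        hF₂.1 16 (by decide), e16]
    · intro a ha
      rw [hi' a (by omega)]
      exact hH a ha _ le_rfl

/-! ### The elimination loop -/

/-- Eliminate all agents but the dummy agent. -/
def eliminate : Program := forLt 20 (iv 0) (.seq findLeaf absorb)

/-- `c` is a coalition of positive value within the resources `U`. -/
def IsProfitable (val : (ℕ → ℕ) → ℝ) (U c : ℕ → ℕ) : Prop := 0 < val c ∧ ∀ i, c i ≤ U i

/-- `i` and `k` can form a coalition of positive value within the resources `U`. -/
def CanInteract (val : (ℕ → ℕ) → ℝ) (U : ℕ → ℕ) (i k : ℕ) : Prop :=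
  ∃ u w, u < U i ∧ w < U k ∧ 0 < val (pairRow i k (u + 1) (w + 1))

/-- An agent without resources can form zero coalitions only, so nothing but its own payoff remains.
-/
theorem eq_of_mem_feasible_singleton {val : (ℕ → ℕ) → ℝ} {U : ℕ → ℕ} {Q : (ℕ → ℕ) → Prop} {n : ℕ}
    {f : ℕ → ℕ → ℝ} {r : ℝ} (hv : val 0 = 0) (hU : U n = 0) (hr : r ∈ feasible val U Q {n} f) :
    r = f n 0 := by
  obtain ⟨L, w, hL, hw, rfl⟩ := hr
  have hw' := hw n (by simp)
  have hz : ∀ c ∈ L, val c = 0 := by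
    intro c hc
    rw [← hv]
    congr 1
    funext i
    by_cases hi : i = n
    · have := Multiset.single_le_sum (fun _ _ => Nat.zero_le _) _
        (Multiset.mem_map_of_mem (fun c : ℕ → ℕ => c n) hc)
      rw [hi, Pi.zero_apply]
      omega
    · exact (hL c hc).2 i (by simpa using hi)
  rw [Multiset.map_congr rfl hz, Finset.sum_singleton, show w n = 0 by omega]
  simp

theorem WP.eliminate {O : Oracles} {B : ℕ} {R : Memory → Prop} {s : Memory} (n : ℕ) (U : ℕ → ℕ)
    (hn : s.idx 0 0 0 = n) (hnB : n ≤ B) (hU : s.idx 1 0 = U) (hUB : ∀ i, U i + 1 ≤ B)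
    (hUn : U n = 0) (hO : O.value 0 = 0) (h4 : s.idx 4 = fun _ _ => 0)
    (h7 : s.idx 7 = fun _ _ => 0)
    (h6 : ∀ i < n, ∀ k < n, 0 < s.idx 6 i k ↔ CanInteract O.value U i k)
    (hpair : ∀ c, IsProfitable O.value U c → ∀ i k, 0 < c i → 0 < c k → i ≠ k →
      CanInteract O.value U i k)
    (hleaf : ∀ A ⊆ Finset.range n, A.Nonempty → ∃ k ∈ A, ∀ i ∈ A, ∀ i' ∈ A, i ≠ k → i' ≠ k →
      CanInteract O.value U i k → CanInteract O.value U i' k → i = i')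
    (h : ∀ s', s'.idx 0 = s.idx 0 → s'.val 0 = s.val 0 →
      (∀ r ∈ feasible O.value U (IsProfitable O.value U) (Finset.range (n + 1)) (s.val 2),
        r ≤ s'.val 2 n 0) →
      s'.val 2 n 0 ∈ feasible O.value U (fun _ => True) (Finset.range (n + 1)) (s.val 2) → R s') :
    WP O B eliminate R s := by
  -- `A` is the set of surviving agents. The upper bound concerns profitable structures and
  -- attainability arbitrary ones; the optimal pair structures from the table may contain worthless
  -- coalitions.
  refine .forLt n hnB (fun t s' => s'.idx 4 = (fun _ _ => 0) ∧ ∃ A ⊆ Finset.range n,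
    A.card = n - t ∧ (∀ i < n, s'.idx 7 0 i = 0 ↔ i ∈ A) ∧
    (∀ r ∈ feasible O.value U (IsProfitable O.value U) (Finset.range (n + 1)) (s.val 2),
      ∃ r' ∈ feasible O.value U (IsProfitable O.value U) (insert n A) (s'.val 2), r ≤ r') ∧
    ∀ r ∈ feasible O.value U (fun _ => True) (insert n A) (s'.val 2),
      r ∈ feasible O.value U (fun _ => True) (Finset.range (n + 1)) (s.val 2))
    (by decide) ?_ ?_ ?_ ?_ ?_
  · intro s' hF
    simp [IdxExpr.eval, iv, hF.1 0 (by decide), hn]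
  · intro m s' x hi
    simpa [write_of_ne] using hi
  · refine ⟨h4, Finset.range n, subset_rfl, by simp, by simp [h7], ?_, ?_⟩
    · intro r hr
      rw [← Finset.range_add_one]
      exact ⟨r, hr, le_rfl⟩
    · rw [← Finset.range_add_one]
      exact fun r hr => hr
  · rintro t ht s₁ hF hv ⟨i4, A, hAn, hcard, hA, hmax, hatt⟩
    have e6 : s₁.idx 6 = s.idx 6 := hF.1 6 (by decide)
    have hlt : ∀ i ∈ A, i < n := fun i hi => Finset.mem_range.1 (hAn hi)
    have hN : ∀ k < n, ∀ i < n, IsNeighbour (s₁.idx 7 0) (s₁.idx 6) k i ↔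
        i ∈ A ∧ i ≠ k ∧ CanInteract O.value U i k := by
      intro k hk i hi
      rw [IsNeighbour, hA i hi, e6, h6 i hi k hk]
      tauto
    refine .seq (.findLeaf n (by rw [hF.1 0 (by decide), hn]) hnB ?_ ?_)
    · obtain ⟨k, hk, hk'⟩ := hleaf A hAn (Finset.card_pos.1 (by omega))
      refine ⟨k, hlt k hk, (hA k (hlt k hk)).2 hk, fun i hi i' hi' h1 h2 => ?_⟩
      rw [hN k (hlt k hk) _ hi] at h1
      rw [hN k (hlt k hk) _ hi'] at h2
      exact hk' i h1.1 i' h2.1 h1.2.1 h2.2.1 h1.2.2 h2.2.2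
    · intro s₂ hF₂ k p hk hp hkn hk0 hpn hkp
      have hkA := (hA k hkn).1 hk0
      have hpk : p ≠ k := by
        rcases hpn with rfl | ⟨-, hpn⟩
        · exact hkn.ne'
        · exact hpn.2.2
      have hpA : p ∈ insert n A := by
        rcases hpn with rfl | ⟨hpn, hpN⟩
        · exact Finset.mem_insert_self _ _
        · exact Finset.mem_insert_of_mem ((hN k hkn p hpn).1 hpN).1
      have herase : (insert n A).erase k = insert n (A.erase k) := by
        rw [Finset.erase_insert_of_ne hkn.ne']
      refine .absorb p k U hp hk hpk
        (by rw [hF₂.1 1 (by decide), hF.1 1 (by decide), hU]) hUB hO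
        (by rw [hF₂.1 4 (by decide), i4]) fun s₃ hF₃ i4' i7 hf hf' =>
        ⟨i4', A.erase k, (Finset.erase_subset _ _).trans hAn, ?_, fun i hi => ?_, fun r hr => ?_,
          fun r hr => ?_⟩
      · rw [Finset.card_erase_of_mem hkA, hcard, Nat.sub_add_eq]
      · rw [i7, hF₂.1 7 (by decide), Finset.mem_erase, ← hA i hi]
        split_ifs with hik <;> simp [hik]
      · rw [hF₂.2 2 (by simp)] at hf hf'
        obtain ⟨r', hr', hle⟩ := hmax r hr
        -- A third contributor cannot be the dummy, which has no resources, and a survivor would be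
        -- a second neighbour of `k`.
        have hQ : ∀ c, IsProfitable O.value U c → (∀ i ∉ insert n A, c i = 0) → 0 < c k →
            ∀ i, i ≠ p → i ≠ k → c i = 0 := by
          intro c hc hcA hck i hip hik
          by_contra hci
          have hiA : i ∈ insert n A := by
            by_contra hiA
            exact hci (hcA i hiA)
          rcases Finset.mem_insert.1 hiA with rfl | hiA
          · have := hc.2 i
            omega
          · exact hip (hkp i (hlt i hiA) ((hN k hkn i (hlt i hiA)).2
              ⟨hiA, hik, hpair c hc i k (Nat.pos_of_ne_zero hci) hck hik⟩))
        obtain ⟨r'', hr'', hle'⟩ :=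
          exists_le_of_feasible (Finset.mem_insert_of_mem hkA) hpA hpk hQ hf hf' hr'
        exact ⟨r'', herase ▸ hr'', hle.trans hle'⟩
      · rw [hF₂.2 2 (by simp)] at hf hf'
        rw [← herase] at hr
        exact hatt r (feasible_of_feasible (Finset.mem_insert_of_mem hkA) hpA hpk hf hf' hr)
  · rintro s' hF ⟨-, A, hAn, hcard, -, hmax, hatt⟩
    obtain rfl : A = ∅ := Finset.card_eq_zero.1 (by omega)
    refine h s' (hF.1 0 (by decide)) (hF.2 0 (by decide)) (fun r hr => ?_) (hatt _ ?_)
    · obtain ⟨r', hr', hle⟩ := hmax r hr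
      exact hle.trans (eq_of_mem_feasible_singleton hO hUn hr').le
    · exact ⟨0, 0, by simp, by simp [hUn], by simp⟩

/-- Decide whether the deviating set can reach the threshold. -/
def decideArbVal : Program :=
  .seq maskWeights <| .seq outerPayments <| .seq findEdges <| .seq eliminate <|
  .cond (.valLe (vv 0) (.read 2 (iv 0) (.const 0)))
    (.setIdx 0 (.const 0) (.const 0) (.const 1)) (.setIdx 0 (.const 0) (.const 0) (.const 0))

/-! ### Interaction takes place along tree edges -/

/-- Without the edge, the subgraph induced on two vertices has no edges at all and is disconnected,
so the reduced game would give `c` the value zero. -/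
theorem Game.adj_of_reduce {n : ℕ} {G : Game n} {T : SimpleGraph (Fin n)} (hG : G = G.reduce T)
    {c : Coalition G.W} {i k : Fin n} (hc : 0 < G.v c) (hs : supp c.1 = {i, k}) (hik : i ≠ k) :
    T.Adj k i := by
  have hv : G.v = (G.reduce T).v := eq_of_heq (congr_arg_heq Game.v hG)
  have hv' : G.v c = if (T.induce (↑(supp c.1) : Set (Fin n))).Connected then G.v c else 0 :=
    congrFun hv c
  by_cases hcon : (T.induce (↑(supp c.1) : Set (Fin n))).Connected
  · rw [hs] at hcon
    by_contra hadj
    have hbot : T.induce (↑({i, k} : Finset (Fin n)) : Set (Fin n)) = ⊥ := by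
      ext ⟨a, ha⟩ ⟨b, hb⟩
      simp only [Finset.coe_insert, Finset.coe_singleton, Set.mem_insert_iff,
        Set.mem_singleton_iff] at ha hb
      simp only [SimpleGraph.comap_adj, Function.Embedding.subtype_apply, SimpleGraph.bot_adj,
        iff_false]
      rcases ha with rfl | rfl <;> rcases hb with rfl | rfl
      · exact T.loopless.irrefl _
      · exact fun h => hadj h.symm
      · exact hadj
      · exact T.loopless.irrefl _
    have := hcon.preconnected ⟨i, by simp⟩ ⟨k, by simp⟩
    rw [hbot, SimpleGraph.reachable_bot] at this
    exact hik (congrArg Subtype.val this)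
  · rw [if_neg hcon] at hv'
    exact absurd hv' hc.ne'

/-! ### The instance as seen by the program -/

namespace ArbInstance

theorem pad_val {α : Type} [Zero α] {m : ℕ} (f : Fin m → α) (i : Fin m) : pad f i = f i := by
  simp [pad]

theorem pad_of_le {α : Type} [Zero α] {m : ℕ} (f : Fin m → α) {i : ℕ} (h : m ≤ i) :
    pad f i = 0 := by
  simp [pad, h]

variable {n : ℕ} (I : ArbInstance n)

/-- The resources of the agents in the deviating set, and zero for the others. -/
def resources (i : ℕ) : ℕ :=
  if i < n ∧ I.input.idx 2 0 i = 0 then 0 else I.input.idx 1 0 i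

/-- Coalition number `j` exists and has a member outside the deviating set. -/
def IsOuter (j : ℕ) : Prop :=
  j < I.o.CS.size ∧ ∃ i < n, 0 < I.input.idx 3 j i ∧ I.input.idx 2 0 i = 0

/-- A member of the deviating set in coalition number `j`, or `n` if there is none. -/
def agent (j : ℕ) : ℕ :=
  if h : ∃ g < n, 0 < I.input.idx 3 j g ∧ 0 < I.input.idx 2 0 g then h.choose else n

theorem coalition_apply (j : Fin I.o.CS.size) (i : Fin n) :
    I.input.idx 3 j i = (I.o.CS.coal j).1 i := by
  change pad (fun j : Fin I.o.CS.size => pad (I.o.CS.coal j).1) j i = _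
  rw [pad_val, pad_val]

theorem coalition_of_le (j : ℕ) {i : ℕ} (h : n ≤ i) : I.input.idx 3 j i = 0 := by
  change pad (fun j : Fin I.o.CS.size => pad (I.o.CS.coal j).1) j i = _
  by_cases hj : j < I.o.CS.size
  · rw [pad, dif_pos hj, pad_of_le _ h]
  · rw [pad_of_le _ (not_lt.1 hj)]
    rfl

theorem member_eq_zero (i : Fin n) : I.input.idx 2 0 i = 0 ↔ i ∉ I.S := by
  change pad (fun i : Fin n => if i ∈ I.S then 1 else 0) i = 0 ↔ _
  rw [pad_val]
  simp

theorem resources_of_mem {i : Fin n} (h : i ∈ I.S) : I.resources i = I.G.W i := by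
  rw [resources, if_neg fun h' => (I.member_eq_zero i).1 h'.2 h]
  exact pad_val _ _

theorem resources_of_notMem {i : Fin n} (h : i ∉ I.S) : I.resources i = 0 :=
  if_pos ⟨i.2, (I.member_eq_zero i).2 h⟩

theorem resources_of_le {i : ℕ} (h : n ≤ i) : I.resources i = 0 := by
  rw [resources, if_neg (by omega)]
  exact pad_of_le _ h

theorem resources_le (i : Fin n) : I.resources i ≤ I.G.W i := by
  by_cases h : i ∈ I.S
  · exact (I.resources_of_mem h).le
  · exact (I.resources_of_notMem h).trans_le (Nat.zero_le _)

theorem resources_le_maxWeight (i : ℕ) : I.resources i ≤ I.G.maxWeight := by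
  by_cases h : i < n
  · exact (I.resources_le ⟨i, h⟩).trans (Finset.le_sup (f := I.G.W) (Finset.mem_univ _))
  · exact (I.resources_of_le (not_lt.1 h)).trans_le (Nat.zero_le _)

theorem isOuter_iff (j : Fin I.o.CS.size) : I.IsOuter j ↔ ¬ supp (I.o.CS.coal j).1 ⊆ I.S := by
  simp only [IsOuter, j.2, true_and, Finset.not_subset, supp, Finset.mem_filter, Finset.mem_univ]
  constructor
  · rintro ⟨i, hi, hc, hm⟩
    exact ⟨⟨i, hi⟩, by rwa [← coalition_apply], (I.member_eq_zero ⟨i, hi⟩).1 hm⟩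
  · rintro ⟨i, hc, hm⟩
    exact ⟨i, i.2, by rwa [coalition_apply], (I.member_eq_zero i).2 hm⟩

theorem value_apply {c : ℕ → ℕ} (h : (fun i : Fin n => c i) ≤ I.G.W) :
    I.oracles.value c = I.G.v ⟨fun i : Fin n => c i, h⟩ := dif_pos h

theorem value_pad (c : Coalition I.G.W) : I.oracles.value (pad c.1) = I.G.v c := by
  have h : (fun i : Fin n => pad c.1 i) = c.1 := funext fun i => pad_val _ _
  rw [I.value_apply (c := pad c.1) (h.symm ▸ c.2)]
  congr 1
  exact Subtype.ext h

theorem value_nonneg (c : ℕ → ℕ) : 0 ≤ I.oracles.value c := by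
  by_cases h : (fun i : Fin n => c i) ≤ I.G.W
  · rw [value_apply _ h]; exact I.G.v_nonneg _
  · exact (show I.oracles.value c = 0 from dif_neg h).ge

theorem value_zero : I.oracles.value 0 = 0 :=
  (I.value_apply (c := 0) fun _ => Nat.zero_le _).trans (I.G.v_zero _ rfl)

/-- Two contributors already exhaust the support of a coalition of positive value in a 2-OCF game.
-/
theorem pair_of_value_pos (hG : I.G.IsKOCF 2) {c : ℕ → ℕ} (hc : 0 < I.oracles.value c)
    {i k : Fin n} (hi : 0 < c i) (hk : 0 < c k) (hik : i ≠ k) :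
    ∃ h : (fun i : Fin n => c i) ≤ I.G.W, 0 < I.G.v ⟨_, h⟩ ∧
      supp (fun i : Fin n => c i) = {i, k} := by
  have h : (fun i : Fin n => c i) ≤ I.G.W := by
    by_contra h
    exact hc.ne' (dif_neg h)
  rw [value_apply _ h] at hc
  refine ⟨h, hc, (Finset.eq_of_subset_of_card_le ?_ ?_).symm⟩
  · intro l hl
    rcases Finset.mem_insert.1 hl with rfl | hl
    · simpa [supp] using hi
    · rw [Finset.mem_singleton.1 hl]
      simpa [supp] using hk
  · rw [Finset.card_pair hik]
    by_contra hcard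
    exact hc.ne' (hG _ (not_le.1 hcard))

theorem canInteract_of_isProfitable (hG : I.G.IsKOCF 2) {c : ℕ → ℕ}
    (hc : IsProfitable I.oracles.value I.resources c) (i k : ℕ) (hi : 0 < c i) (hk : 0 < c k)
    (hik : i ≠ k) : CanInteract I.oracles.value I.resources i k := by
  have hlt : ∀ l, 0 < c l → l < n := fun l hl => by
    by_contra h
    have := hc.2 l
    rw [I.resources_of_le (not_lt.1 h)] at this
    omega
  have hi' := hlt i hi
  have hk' := hlt k hk
  obtain ⟨-, -, hs⟩ := I.pair_of_value_pos hG hc.1 (i := ⟨i, hi'⟩) (k := ⟨k, hk'⟩) hi hk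
    (fun h => hik (congrArg Fin.val h))
  have hrow : c = pairRow i k (c i - 1 + 1) (c k - 1 + 1) := by
    funext l
    rw [Nat.sub_add_cancel hi, Nat.sub_add_cancel hk]
    simp only [pairRow]
    split_ifs with h1 h2
    · rw [h1]
    · rw [h2]
    · by_contra hl
      have hl' := hlt l (Nat.pos_of_ne_zero hl)
      have : (⟨l, hl'⟩ : Fin n) ∈ supp (fun i : Fin n => c i) := by
        simpa [supp] using Nat.pos_of_ne_zero hl
      rw [hs] at this
      simp [h1, h2] at this
  have h1 := hc.2 i
  have h2 := hc.2 k
  exact ⟨c i - 1, c k - 1, by omega, by omega, hrow ▸ hc.1⟩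

/-- The graph of interacting pairs is a subgraph of the hidden tree, so a leaf provided by
`exists_leaf` has at most one partner. -/
theorem exists_leaf_of_tree (hG : I.G.IsKOCF 2) (hT : I.G.HasTreeInteraction)
    (A : Finset ℕ) (hA : A ⊆ Finset.range n) (hne : A.Nonempty) :
    ∃ k ∈ A, ∀ i ∈ A, ∀ i' ∈ A, i ≠ k → i' ≠ k →
      CanInteract I.oracles.value I.resources i k →
      CanInteract I.oracles.value I.resources i' k → i = i' := by
  obtain ⟨T, hT, hGT⟩ := hT
  have hlt : ∀ i ∈ A, i < n := fun i hi => Finset.mem_range.1 (hA hi)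
  obtain ⟨k, hk, h⟩ := exists_leaf hT (A := Finset.univ.filter fun i : Fin n => (i : ℕ) ∈ A) (by
    obtain ⟨a, ha⟩ := hne
    exact ⟨⟨a, hlt a ha⟩, by simpa using ha⟩)
  have adj : ∀ i (hi : i ∈ A), i ≠ k → CanInteract I.oracles.value I.resources i k →
      T.Adj k ⟨i, hlt i hi⟩ := by
    rintro i hi hik ⟨u, w, -, -, hpos⟩
    have hne : (⟨i, hlt i hi⟩ : Fin n) ≠ k := fun h => hik (congrArg Fin.val h)
    obtain ⟨hle, hpos', hs⟩ := I.pair_of_value_pos hG hpos (i := ⟨i, hlt i hi⟩) (k := k)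
      (by simp [pairRow, hik]) (by simp [pairRow]) hne
    exact Game.adj_of_reduce hGT hpos' hs hne
  refine ⟨k, by simpa using hk, fun i hi i' hi' hik hik' hc hc' => ?_⟩
  exact congrArg Fin.val (h ⟨i, hlt i hi⟩ (by simpa using hi) ⟨i', hlt i' hi'⟩ (by simpa using hi')
    (adj i hi hik hc) (adj i' hi' hik' hc'))

theorem isAgentOf_agent (j : ℕ) :
    IsAgentOf n (I.input.idx 2 0) (I.input.idx 3 j) (I.agent j) := by
  rw [agent]
  split_ifs with h
  · exact Or.inr h.choose_spec
  · push Not at h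
    exact Or.inl ⟨rfl, fun i hi hc => Nat.le_zero.1 (h i hi hc)⟩

/-- A coalition with a member outside of the deviating set has at most one member inside. -/
theorem eq_of_isOuter (hsize : ∀ j, (supp (I.o.CS.coal j).1).card ≤ 2) {j : ℕ}
    (hj : I.IsOuter j) {i i' : ℕ} (hi : i < n) (hi' : i' < n)
    (hc : 0 < I.input.idx 3 j i) (hc' : 0 < I.input.idx 3 j i')
    (hm : 0 < I.input.idx 2 0 i) (hm' : 0 < I.input.idx 2 0 i') : i = i' := by
  obtain ⟨hj, k, hk, hck, hmk⟩ := hj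
  by_contra hne
  have hsub : ({⟨i, hi⟩, ⟨i', hi'⟩, ⟨k, hk⟩} : Finset (Fin n)) ⊆
      supp (I.o.CS.coal ⟨j, hj⟩).1 := by
    have hmem : ∀ l : Fin n, 0 < I.input.idx 3 j l → l ∈ supp (I.o.CS.coal ⟨j, hj⟩).1 := by
      intro l hl
      simpa [supp, ← coalition_apply] using hl
    intro l hl
    simp only [Finset.mem_insert, Finset.mem_singleton] at hl
    rcases hl with rfl | rfl | rfl <;> exact hmem _ (by assumption)
  have hcard : ({⟨i, hi⟩, ⟨i', hi'⟩, ⟨k, hk⟩} : Finset (Fin n)).card = 3 := by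
    rw [Finset.card_eq_three]
    refine ⟨_, _, _, ?_, ?_, ?_, rfl⟩ <;> intro h <;> have h := congrArg Fin.val h
    · exact hne h
    · simp only at h
      subst h
      omega
    · simp only at h
      subst h
      omega
  have := (Finset.card_le_card hsub).trans (hsize ⟨j, hj⟩)
  omega

theorem eq_agent (hsize : ∀ j, (supp (I.o.CS.coal j).1).card ≤ 2) {j : ℕ} (hj : I.IsOuter j)
    {g : ℕ} (hg : IsAgentOf n (I.input.idx 2 0) (I.input.idx 3 j) g) : g = I.agent j := by
  rcases hg with ⟨rfl, h⟩ | ⟨h1, h2, h3⟩ <;>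
    rcases I.isAgentOf_agent j with ⟨h4, h'⟩ | ⟨h4, h5, h6⟩
  · exact h4.symm
  · exact absurd (h _ h4 h5) h6.ne'
  · exact absurd (h' _ h1 h2) h3.ne'
  · exact I.eq_of_isOuter hsize hj h1 h4 h2 h5 h3 h6

end ArbInstance

/-! ### Deviations and feasible structures -/

namespace ArbInstance

variable {n : ℕ} (I : ArbInstance n)

/-- The outer coalitions for which agent `i` withdraws. -/
def outerOf (i : ℕ) : Finset ℕ :=
  (Finset.range I.o.CS.size).filter fun j => I.IsOuter j ∧ I.agent j = i

theorem sum_outer {M : Type} [AddCommMonoid M] (g : ℕ → M) :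
    ∑ j : I.o.CS.Outer I.S, g j.1 = ∑ j ∈ (Finset.range I.o.CS.size).filter I.IsOuter, g j := by
  rw [Finset.sum_filter, ← Fin.sum_univ_eq_sum_range (fun j => if I.IsOuter j then g j else 0),
    ← Finset.sum_filter]
  exact (Finset.sum_subtype (Finset.univ.filter fun j : Fin I.o.CS.size => I.IsOuter j)
    (fun j => by simp [isOuter_iff]) fun j => g j).symm

theorem agent_le (j : ℕ) : I.agent j ≤ n := by
  rcases I.isAgentOf_agent j with h | h <;> omega

/-- The index `n` in the range accounts for outer coalitions without contributor in the deviating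
set. -/
theorem sum_outer_eq_sum_outerOf {M : Type} [AddCommMonoid M] (g : ℕ → M) :
    ∑ j : I.o.CS.Outer I.S, g j.1 = ∑ i ∈ Finset.range (n + 1), ∑ j ∈ I.outerOf i, g j := by
  rw [sum_outer, ← Finset.sum_fiberwise_of_maps_to (g := I.agent) (t := Finset.range (n + 1))
    fun j _ => Finset.mem_range.2 (Nat.lt_succ_of_le (I.agent_le j))]
  refine Finset.sum_congr rfl fun i _ => ?_
  rw [Finset.filter_filter]
  rfl

theorem outerOf_eq_empty {i : Fin n} (hi : i ∉ I.S) : I.outerOf i = ∅ := by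
  refine Finset.filter_eq_empty_iff.2 fun j _ hj => ?_
  have h0 := (I.member_eq_zero i).2 hi
  rcases I.isAgentOf_agent j with ⟨h, -⟩ | ⟨-, -, h⟩
  · have := i.2
    omega
  · rw [hj.2] at h
    omega

/-- What the agent withdraws from coalition number `j`. -/
def withdrawal {I : ArbInstance n} (D : Deviation I.o.CS I.S) (j : ℕ) : ℕ :=
  if h : ∃ hj : j < I.o.CS.size, ¬ supp (I.o.CS.coal ⟨j, hj⟩).1 ⊆ I.S then
    pad (D.d ⟨⟨j, h.1⟩, h.2⟩) (I.agent j) else 0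

theorem withdrawal_apply {I : ArbInstance n} (D : Deviation I.o.CS I.S) (j : I.o.CS.Outer I.S) :
    withdrawal D j.1 = pad (D.d j) (I.agent j.1) := dif_pos ⟨j.1.2, j.2⟩

theorem withdrawal_le {I : ArbInstance n} (D : Deviation I.o.CS I.S) (j : ℕ) :
    withdrawal D j ≤ I.input.idx 3 j (I.agent j) := by
  rw [withdrawal]
  split_ifs with h
  · by_cases hg : I.agent j < n
    · have := D.d_le ⟨⟨j, h.1⟩, h.2⟩ ⟨I.agent j, hg⟩
      rw [← coalition_apply] at this
      rw [pad, dif_pos hg]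
      exact this
    · rw [pad_of_le _ (not_lt.1 hg)]
      exact Nat.zero_le _
  · exact Nat.zero_le _

theorem coalition_eq_zero (hsize : ∀ j, (supp (I.o.CS.coal j).1).card ≤ 2)
    (j : I.o.CS.Outer I.S) {i : Fin n} (hi : i ∈ I.S) (hne : (i : ℕ) ≠ I.agent j.1) :
    (I.o.CS.coal j.1).1 i = 0 := by
  by_contra h
  refine hne (I.eq_agent hsize ((I.isOuter_iff j.1).2 j.2) (Or.inr ⟨i.2, ?_, ?_⟩))
  · rw [coalition_apply]
    exact Nat.pos_of_ne_zero h
  · exact Nat.pos_of_ne_zero fun h => (I.member_eq_zero i).1 h hi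

theorem agent_mem {j : ℕ} (h : I.agent j < n) : (⟨I.agent j, h⟩ : Fin n) ∈ I.S := by
  by_contra hS
  have h0 := (I.member_eq_zero ⟨I.agent j, h⟩).2 hS
  rcases I.isAgentOf_agent j with ⟨h', -⟩ | ⟨-, -, h'⟩
  · omega
  · exact h'.ne' h0

theorem withdraws_apply {I : ArbInstance n} (hsize : ∀ j, (supp (I.o.CS.coal j).1).card ≤ 2)
    (D : Deviation I.o.CS I.S) (j : I.o.CS.Outer I.S) (i : Fin n) :
    D.d j i = if (i : ℕ) = I.agent j.1 then withdrawal D j.1 else 0 := by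
  split_ifs with h
  · rw [withdrawal_apply, ← h, pad_val]
  · by_cases hi : i ∈ I.S
    · have := D.d_le j i
      rw [I.coalition_eq_zero hsize j hi h] at this
      exact Nat.le_zero.1 this
    · exact D.d_out j i hi

/-- This is where locality enters: the queried deviation and `D` agree on the row of `j`, since only
the agent of `j` can withdraw from it. -/
theorem payment_single (hsize : ∀ j, (supp (I.o.CS.coal j).1).card ≤ 2) (hA : I.A.IsLocal)
    (D : Deviation I.o.CS I.S) (j : I.o.CS.Outer I.S) :
    I.oracles.payment (single j.1 (I.agent j.1) (withdrawal D j.1)) j.1 = I.A I.o I.S D j := by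
  have h : (∃ hk : j.1.1 < I.o.CS.size, ¬ supp (I.o.CS.coal ⟨j.1, hk⟩).1 ⊆ I.S) ∧
      (∀ l : I.o.CS.Outer I.S, (fun i : Fin n =>
        single j.1 (I.agent j.1) (withdrawal D j.1) l.1 i) ≤ (I.o.CS.coal l.1).1) ∧
      ∀ l : I.o.CS.Outer I.S, ∀ i ∉ I.S,
        single j.1 (I.agent j.1) (withdrawal D j.1) l.1 i = 0 := by
    refine ⟨⟨j.1.2, j.2⟩, fun l i => ?_, fun l i hi => ?_⟩ <;> simp only [single]
    · split_ifs with h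
      · rw [← coalition_apply, h.1, h.2]
        exact withdrawal_le D _
      · exact Nat.zero_le _
    · refine if_neg fun h => hi ?_
      have := I.agent_mem (j := j.1) (h.2 ▸ i.2)
      convert this using 1
      exact Fin.ext h.2
  obtain ⟨f, hf⟩ := hA
  refine (dif_pos h).trans ?_
  rw [hf, hf]
  congr 1
  funext i
  simp only [withdraws_apply hsize D j i, single, true_and]

/-- The payoffs of agent `i` from the outer coalitions if it leaves `w` units in them. -/
def agentPayments (i w : ℕ) : Set ℝ :=
  payments (fun j t => I.oracles.payment (single j i t) j) (fun j => I.input.idx 3 j i)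
    (I.outerOf i) w

theorem sum_payments (hsize : ∀ j, (supp (I.o.CS.coal j).1).card ≤ 2) (hA : I.A.IsLocal)
    (D : Deviation I.o.CS I.S) :
    ∑ j, I.A I.o I.S D j = ∑ i ∈ Finset.range (n + 1), ∑ j ∈ I.outerOf i,
      I.oracles.payment (single j i (withdrawal D j)) j := by
  rw [← Finset.sum_congr rfl fun j _ => I.payment_single hsize hA D j,
    I.sum_outer_eq_sum_outerOf
      fun j => I.oracles.payment (single j (I.agent j) (withdrawal D j)) j]
  refine Finset.sum_congr rfl fun i _ => Finset.sum_congr rfl fun j hj => ?_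
  rw [(Finset.mem_filter.1 hj).2.2]

theorem sum_retained (hsize : ∀ j, (supp (I.o.CS.coal j).1).card ≤ 2)
    (D : Deviation I.o.CS I.S) {i : Fin n} (hi : i ∈ I.S) :
    ∑ j : I.o.CS.Outer I.S, ((I.o.CS.coal j.1).1 i - D.d j i) =
      ∑ j ∈ I.outerOf i, (I.input.idx 3 j i - withdrawal D j) := by
  have h : ∀ j : I.o.CS.Outer I.S, (I.o.CS.coal j.1).1 i - D.d j i =
      if I.agent j.1 = i then I.input.idx 3 j.1 i - withdrawal D j.1 else 0 := by
    intro j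
    rw [withdraws_apply hsize D j i, ← coalition_apply]
    split_ifs with h1 h2 h2
    · rfl
    · exact absurd h1.symm h2
    · exact absurd h2.symm h1
    · rw [coalition_apply, I.coalition_eq_zero hsize j hi h1]
  rw [Finset.sum_congr rfl fun j _ => h j, I.sum_outer
    fun j => if I.agent j = i then I.input.idx 3 j i - withdrawal D j else 0, ← Finset.sum_filter,
    Finset.filter_filter]
  rfl

variable {I} {f : ℕ → ℕ → ℝ}

/-- Worthless coalitions are dropped, and the weight this frees, together with any unused weight,
goes to the agents' leftovers. That can only help, as `payments` bounds the retained amounts by an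
inequality. -/
theorem exists_feasible_of_deviation (hsize : ∀ j, (supp (I.o.CS.coal j).1).card ≤ 2)
    (hA : I.A.IsLocal)
    (hf : ∀ i, ∀ w ≤ I.resources i, IsGreatest (I.agentPayments i w) (f i w)) {r : ℝ}
    (hr : r ∈ deviationPayoffs I.A I.o I.S) :
    ∃ r' ∈ feasible I.oracles.value I.resources
      (IsProfitable I.oracles.value I.resources) (Finset.range (n + 1)) f, r ≤ r' := by
  obtain ⟨D, CS, ⟨hS, hW⟩, rfl⟩ := hr
  set L₀ : Multiset (ℕ → ℕ) :=
    (Finset.univ : Finset (Fin CS.size)).val.map fun j => pad (CS.coal j).1 with hL₀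
  set L := L₀.filter fun c => 0 < I.oracles.value c with hL
  have hsum₀ : ∀ i : Fin n, (L₀.map fun c => c i).sum = CS.weight i := by
    intro i
    rw [hL₀, Multiset.map_map]
    exact Finset.sum_congr rfl fun j _ => pad_val _ _
  have hsum : ∀ i : Fin n, (L.map fun c => c i).sum ≤ CS.weight i := by
    intro i
    rw [← hsum₀, ← Multiset.filter_add_not (fun c => 0 < I.oracles.value c) L₀, Multiset.map_add,
      Multiset.sum_add]
    exact Nat.le_add_right _ _
  have hpad : ∀ c ∈ L, ∃ j, c = pad (CS.coal j).1 := by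
    intro c hc
    obtain ⟨j, -, hj⟩ := Multiset.mem_map.1 (Multiset.mem_filter.1 hc).1
    exact ⟨j, hj.symm⟩
  have hle : ∀ c ∈ L, ∀ i, c i ≤ I.resources i := by
    intro c hc i
    obtain ⟨j, rfl⟩ := hpad c hc
    by_cases hi : i < n
    · lift i to Fin n using hi
      rw [pad_val]
      by_cases hiS : i ∈ I.S
      · rw [I.resources_of_mem hiS]
        exact (CS.coal j).2 i
      · have : i ∉ supp (CS.coal j).1 := fun h => hiS (hS j h)
        simp only [supp, Finset.mem_filter, Finset.mem_univ, true_and] at this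
        omega
    · rw [pad_of_le _ (not_lt.1 hi)]
      exact Nat.zero_le _
  have hcap : ∀ i, (L.map fun c => c i).sum +
      ∑ j ∈ I.outerOf i, (I.input.idx 3 j i - withdrawal D j) ≤ I.resources i := by
    intro i
    by_cases hi : i < n
    · lift i to Fin n using hi
      by_cases hiS : i ∈ I.S
      · have h1 := hW i hiS
        have h2 := hsum i
        rw [I.sum_retained hsize D hiS] at h1
        rw [I.resources_of_mem hiS]
        omega
      · rw [I.outerOf_eq_empty hiS, sum_coordinate_eq_zero fun c hc => Nat.le_zero.1
          ((hle c hc i).trans_eq (I.resources_of_notMem hiS))]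
        exact Nat.zero_le _
    · rw [sum_coordinate_eq_zero fun c hc => Nat.le_zero.1
        ((hle c hc i).trans_eq (I.resources_of_le (not_lt.1 hi))),
        Finset.sum_eq_zero fun j _ => by rw [I.coalition_of_le j (not_lt.1 hi), Nat.zero_sub]]
      exact Nat.zero_le _
  refine ⟨_, ⟨L, fun i => I.resources i - (L.map fun c => c i).sum, fun c hc => ⟨⟨?_, hle c hc⟩, ?_⟩,
    fun i _ => ?_, rfl⟩, add_le_add ?_ ?_⟩
  · exact (Multiset.mem_filter.1 hc).2
  · intro i hi
    have h1 := hle c hc i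
    rw [I.resources_of_le (by simp at hi; omega)] at h1
    exact Nat.le_zero.1 h1
  · have := hcap i
    dsimp only
    omega
  · have hval : CS.value = (L₀.map I.oracles.value).sum := by
      rw [hL₀, Multiset.map_map]
      exact Finset.sum_congr rfl fun j _ => (I.value_pad _).symm
    rw [hval, ← Multiset.filter_add_not (fun c => 0 < I.oracles.value c) L₀, Multiset.map_add,
      Multiset.sum_add, ← hL]
    have h0 : ∀ c ∈ L₀.filter fun c => ¬ 0 < I.oracles.value c, I.oracles.value c = 0 := fun c hc =>
      le_antisymm (not_lt.1 (Multiset.mem_filter.1 hc).2) (I.value_nonneg c)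
    rw [Multiset.map_congr rfl h0]
    simp
  -- The amounts that `D` leaves in the outer coalitions are one admissible choice in each agent's
  -- knapsack.
  · rw [I.sum_payments hsize hA D]
    refine Finset.sum_le_sum fun i _ => (hf i _ (Nat.sub_le _ _)).2
      ⟨fun j => I.input.idx 3 j i - withdrawal D j, fun j _ => Nat.sub_le _ _, ?_,
        Finset.sum_congr rfl fun j hj => ?_⟩
    · have := hcap i
      dsimp only
      omega
    · have := withdrawal_le D j
      rw [(Finset.mem_filter.1 hj).2.2] at this
      dsimp only
      rw [Nat.sub_sub_self this]

/-- Each `f i (w i)` is attained by some retained amounts `u i`; together these define one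
deviation, because every outer coalition belongs to a single agent. -/
theorem mem_deviationPayoffs_of_feasible (hsize : ∀ j, (supp (I.o.CS.coal j).1).card ≤ 2)
    (hA : I.A.IsLocal)
    (hf : ∀ i, ∀ w ≤ I.resources i, IsGreatest (I.agentPayments i w) (f i w)) {r : ℝ}
    (hr : r ∈ feasible I.oracles.value I.resources (fun _ => True) (Finset.range (n + 1)) f) :
    r ∈ deviationPayoffs I.A I.o I.S := by
  obtain ⟨L, w, -, hw, rfl⟩ := hr
  obtain ⟨m, g, rfl⟩ : ∃ (m : ℕ) (g : Fin m → ℕ → ℕ), L = (Finset.univ : Finset (Fin m)).val.map g := by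
    induction L using Quotient.inductionOn with
    | h l =>
      refine ⟨l.length, l.get, ?_⟩
      simp [Fin.univ_val_map]
  have hsum : ∀ {M : Type} [AddCommMonoid M] (h : (ℕ → ℕ) → M),
      (((Finset.univ : Finset (Fin m)).val.map g).map h).sum = ∑ j, h (g j) := by
    intro M _ h
    rw [Multiset.map_map]
    rfl
  simp only [hsum] at hw ⊢
  have hwi : ∀ i : Fin n, ∑ j, g j i + w i = I.resources i := fun i =>
    hw i (Finset.mem_range.2 (by omega))
  have hg : ∀ j, ∀ i : Fin n, g j i ≤ I.resources i := by
    intro j i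
    have := Finset.single_le_sum (f := fun j => g j i) (fun _ _ => Nat.zero_le _)
      (Finset.mem_univ j)
    have h2 := hwi i
    omega
  have hgW : ∀ j, (fun i : Fin n => g j i) ≤ I.G.W := fun j i =>
    (hg j i).trans (I.resources_le i)
  have hu : ∀ i : ℕ, ∃ u : ℕ → ℕ, i ∈ Finset.range (n + 1) →
      (∀ j ∈ I.outerOf i, u j ≤ I.input.idx 3 j i) ∧ ∑ j ∈ I.outerOf i, u j ≤ w i ∧
      f i (w i) = ∑ j ∈ I.outerOf i,
        I.oracles.payment (single j i (I.input.idx 3 j i - u j)) j := by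
    intro i
    by_cases hi : i ∈ Finset.range (n + 1)
    · obtain ⟨u, hu⟩ := (hf i (w i) (by have := hw i hi; omega)).1
      exact ⟨u, fun _ => hu⟩
    · exact ⟨0, fun h => absurd h hi⟩
  choose u hu using hu
  let D : Deviation I.o.CS I.S :=
    { d := fun j i => if (i : ℕ) = I.agent j.1 then (I.o.CS.coal j.1).1 i - u i j.1 else 0
      d_le := fun j i => by
        dsimp only
        split_ifs
        · exact Nat.sub_le _ _
        · exact Nat.zero_le _
      d_out := fun j i hi => if_neg fun h => hi <| by
        have := I.agent_mem (j := j.1) (h ▸ i.2)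
        convert this using 1
        exact Fin.ext h }
  have hD : ∀ i, ∀ j ∈ I.outerOf i, withdrawal D j = I.input.idx 3 j i - u i j := by
    intro i j hj
    obtain ⟨hj', ho, rfl⟩ := Finset.mem_filter.1 hj
    lift j to Fin I.o.CS.size using Finset.mem_range.1 hj'
    rw [withdrawal_apply D ⟨j, (I.isOuter_iff j).1 ho⟩]
    by_cases hg : I.agent j < n
    · rw [pad, dif_pos hg]
      simp only [D, if_true]
      rw [← coalition_apply]
    -- The dummy agent contributes nothing, so both sides vanish.
    · rw [pad_of_le _ (not_lt.1 hg), I.coalition_of_le _ (not_lt.1 hg), Nat.zero_sub]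
  refine ⟨D, ⟨m, fun j => ⟨fun i => g j i, hgW j⟩, fun i => ?_⟩, ⟨fun j i hi => ?_, fun i hi => ?_⟩,
    ?_⟩
  · have h1 := hwi i
    have h2 := I.resources_le i
    dsimp only
    omega
  · by_contra hiS
    have h1 := hg j i
    rw [I.resources_of_notMem hiS] at h1
    simp only [supp, Finset.mem_filter] at hi
    omega
  · rw [I.sum_retained hsize D hi]
    have hi' : (i : ℕ) ∈ Finset.range (n + 1) := Finset.mem_range.2 (by omega)
    rw [Finset.sum_congr rfl fun j hj => by
      rw [hD i j hj, Nat.sub_sub_self ((hu i hi').1 j hj)]]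
    have h1 := hwi i
    rw [I.resources_of_mem hi] at h1
    have h2 := (hu i hi').2.1
    change ∑ j, g j i + ∑ j ∈ I.outerOf i, u i j ≤ _
    omega
  · rw [I.sum_payments hsize hA D]
    congr 1
    · exact Finset.sum_congr rfl fun j _ => I.value_apply (hgW j)
    · refine Finset.sum_congr rfl fun i hi => (hu i hi).2.2.trans ?_
      exact Finset.sum_congr rfl fun j hj => by rw [hD i j hj]

end ArbInstance

/-! ### Correctness and running time -/

namespace ArbInstance

variable {n : ℕ} (I : ArbInstance n)

/-- Bounds the number of agents, the number of coalitions, and the number of amounts that an agent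
can contribute. -/
def iterations : ℕ := (n + 1) * (I.G.maxWeight + 1)

/-- A coalition with nonempty support uses at least one of the at most `n * I.G.maxWeight` units of
weight. -/
theorem size_le (hpos : ∀ j, 1 ≤ (supp (I.o.CS.coal j).1).card) :
    I.o.CS.size ≤ I.iterations := by
  have hcard : ∀ j, 1 ≤ ∑ i, (I.o.CS.coal j).1 i := by
    intro j
    obtain ⟨i, hi⟩ := Finset.card_pos.1 (hpos j)
    exact (show 0 < (I.o.CS.coal j).1 i by simpa [supp] using hi).trans_le
      (Finset.single_le_sum (fun _ _ => Nat.zero_le _) (Finset.mem_univ i))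
  calc I.o.CS.size = ∑ _j : Fin I.o.CS.size, 1 := by simp
    _ ≤ ∑ j, ∑ i, (I.o.CS.coal j).1 i := Finset.sum_le_sum fun j _ => hcard j
    _ = ∑ i, ∑ j, (I.o.CS.coal j).1 i := Finset.sum_comm
    _ ≤ ∑ _i : Fin n, I.G.maxWeight := Finset.sum_le_sum fun i _ =>
        (I.o.CS.feasible i).trans (Finset.le_sup (f := I.G.W) (Finset.mem_univ i))
    _ = n * I.G.maxWeight := by simp
    _ ≤ I.iterations := Nat.mul_le_mul (Nat.le_succ _) (Nat.le_succ _)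

variable {I}

/-- The two halves of the sandwich meet: `r` is a deviation payoff and bounds all of them, so the
supremum is a maximum equal to `r`. -/
theorem isYes_iff (hsize : ∀ j, (supp (I.o.CS.coal j).1).card ≤ 2) (hA : I.A.IsLocal)
    {f : ℕ → ℕ → ℝ} {r : ℝ}
    (hf : ∀ i, ∀ w ≤ I.resources i, IsGreatest (I.agentPayments i w) (f i w))
    (hmax : ∀ r' ∈ feasible I.oracles.value I.resources
      (IsProfitable I.oracles.value I.resources) (Finset.range (n + 1)) f, r' ≤ r)
    (hatt : r ∈ feasible I.oracles.value I.resources (fun _ => True) (Finset.range (n + 1)) f) :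
    I.IsYes ↔ (I.V : ℝ) ≤ r := by
  have h : IsGreatest (deviationPayoffs I.A I.o I.S) r := by
    refine ⟨mem_deviationPayoffs_of_feasible hsize hA hf hatt, fun x hx => ?_⟩
    obtain ⟨r', hr', hle⟩ := exists_feasible_of_deviation hsize hA hf hx
    exact hle.trans (hmax r' hr')
  rw [IsYes, ArbitrationFunction.best, h.csSup_eq]

theorem wp_decideArbVal (hG : I.G.IsKOCF 2) (hT : I.G.HasTreeInteraction) (hA : I.A.IsLocal)
    (hpos : ∀ j, 1 ≤ (supp (I.o.CS.coal j).1).card)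
    (hsize : ∀ j, (supp (I.o.CS.coal j).1).card ≤ 2) :
    WP I.oracles I.iterations decideArbVal
      (fun s => s.idx 0 0 0 = if I.IsYes then 1 else 0) I.input := by
  have hnB : n ≤ I.iterations :=
    (Nat.le_succ n).trans (Nat.le_mul_of_pos_right _ (Nat.succ_pos _))
  have hUB : ∀ i, I.resources i + 1 ≤ I.iterations := fun i =>
    (Nat.succ_le_succ (I.resources_le_maxWeight i)).trans
      (Nat.le_mul_of_pos_left _ (Nat.succ_pos _))
  have h0 : I.input.idx 0 0 0 = n := rfl
  have h0' : I.input.idx 0 0 1 = I.o.CS.size := rfl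
  have hz : ∀ a, 4 ≤ a → I.input.idx a = fun _ _ => 0 := by
    intro a ha
    obtain ⟨a, rfl⟩ := Nat.exists_eq_add_of_le' ha
    rfl
  refine .seq (.maskWeights n h0 hnB fun s₁ hF₁ h1 => .seq ?_)
  have h1' : s₁.idx 1 0 = I.resources := funext h1
  have e2 : s₁.idx 2 = I.input.idx 2 := hF₁.1 2 (by decide)
  have e3 : s₁.idx 3 = I.input.idx 3 := hF₁.1 3 (by decide)
  refine .outerPayments n I.o.CS.size I.resources I.agent I.IsOuter
    (by rw [hF₁.1 0 (by decide), h0]) (by rw [hF₁.1 0 (by decide), h0']) hnB (I.size_le hpos) h1'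
    hUB (by rw [hF₁.1 5 (by decide), hz 5 (by decide)]) (hF₁.2 2 (by simp)) ?_ ?_
    fun s₂ hF₂ hf => .seq ?_
  · intro j hj
    rw [e2, e3, IsOuter, and_iff_right hj]
  · intro j hj ho g hg
    rw [e2, e3] at hg
    exact I.eq_agent hsize ho hg
  rw [e3] at hf
  have e1 : s₂.idx 1 0 = I.resources := by rw [hF₂.1 1 (by decide), h1']
  refine .findEdges n I.resources (by rw [hF₂.1 0 (by decide), hF₁.1 0 (by decide), h0]) hnB e1
    (fun i => (Nat.le_succ _).trans (hUB i))
    (by rw [hF₂.1 4 (by decide), hF₁.1 4 (by decide), hz 4 (by decide)])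
    (by rw [hF₂.1 6 (by decide), hF₁.1 6 (by decide), hz 6 (by decide)])
    fun s₃ hF₃ h4 h6 => .seq ?_
  have v2 : s₃.val 2 = s₂.val 2 := hF₃.2 2 (by simp)
  have i0 : s₃.idx 0 = I.input.idx 0 := by
    rw [hF₃.1 0 (by decide), hF₂.1 0 (by decide), hF₁.1 0 (by decide)]
  have v0 : s₃.val 0 = I.input.val 0 := by
    rw [hF₃.2 0 (by simp), hF₂.2 0 (by simp), hF₁.2 0 (by simp)]
  refine .eliminate n I.resources (by rw [i0, h0]) hnB (by rw [hF₃.1 1 (by decide), e1]) hUB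
    (I.resources_of_le le_rfl) I.value_zero h4
    (by rw [hF₃.1 7 (by decide), hF₂.1 7 (by decide), hF₁.1 7 (by decide), hz 7 (by decide)]) h6
    (fun c hc => I.canInteract_of_isProfitable hG hc) (I.exists_leaf_of_tree hG hT)
    fun s₄ h0'' hv0 hmax hatt => ?_
  rw [v2] at hmax hatt
  have hyes := isYes_iff hsize hA hf hmax hatt
  have hV : s₄.val 0 0 0 = I.V := by rw [hv0, v0]; rfl
  refine .cond (fun hb => .setIdx ?_) (fun hb => .setIdx ?_)
  all_goals
    simp only [Test.holds, ValExpr.eval, IdxExpr.eval, vv, iv, h0'', i0, h0, hV, ← hyes] at hb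
    simp [write, IdxExpr.eval, hb]

end ArbInstance

end OCF

end

theorem mainTheorem5 :
    ∃ (P : OCF.Program) (p : MvPolynomial (Fin 2) ℕ),
      ∀ (n : ℕ) (I : OCF.ArbInstance n),
        I.G.IsKOCF 2 →
        I.G.HasTreeInteraction →
        I.A.IsLocal →
        (∀ j, 1 ≤ (OCF.supp (I.o.CS.coal j).1).card ∧ (OCF.supp (I.o.CS.coal j).1).card ≤ 2) →
        I.DecidedWithin P (MvPolynomial.eval ![n, I.G.maxWeight] p) := by
  obtain ⟨C, d, hC⟩ := OCF.decideArbVal.exists_bound_le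
  -- The polynomial is `C * (B + 1) ^ d` with the iteration bound `B = (n + 1) * (W_M + 1)`
  -- substituted.
  refine ⟨OCF.decideArbVal, .C C * ((.X 0 + 1) * (.X 1 + 1) + 1) ^ d,
    fun n I hG hT hA hcard => ?_⟩
  obtain ⟨s, t, hrun, ht, hs⟩ := OCF.ArbInstance.wp_decideArbVal hG hT hA (fun j => (hcard j).1)
    fun j => (hcard j).2
  refine ⟨s, t, hrun, ht.trans ((hC _).trans_eq ?_), hs⟩
  simp [OCF.ArbInstance.iterations]
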